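/- Let $n,m\ge 0$ be integers, let $c_1,\dots,c_m>0$ be real numbers and let $B_i\colon\mathbb R^n\to\mathbb R^{n_i}$ ($i\le m$) be surjective linear maps, identified with their matrices in the standard bases, such that $\sum_{i=1}^m c_i n_i=n$. The Brascamp–Lieb constant of $(c_1,B_1),\dots,(c_m,B_m)$ is the smallest real number $C$ such that $$\int_{\mathbb R^n}\prod_{i=1}^m f_i(B_ix)^{c_i}\,dx\;\le\; C\prod_{i=1}^m\Bigl(\int_{\mathbb R^{n_i}}f_i(y)\,dy\Bigr)^{c_i}\qquad(\ast)$$ for all non-negative integrable functions $f_i\colon\mathbb R^{n_i}\to\mathbb R$ (in particular the left-hand side is finite). Suppose that $A$ is a symmetric positive definite real $n\times n$ matrix with $$A^{-1}=\sum_{i=1}^m c_i\,B_i^*\,(B_iAB_i^*)^{-1}B_i .$$ Then the Brascamp–Lieb constant exists and equals $$C=\Bigl(\frac{\det(A)}{\prod_{i=1}^m\det(B_iAB_i^*)^{c_i}}\Bigr)^{1/2},$$ and, with this $C$, equality holds in $(\ast)$, with all integrals finite, for the centered Gaussian functions $f_i(x)=\exp\bigl(-\langle (B_iAB_i^*)^{-1}x,x\rangle/2\bigr)$,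 $i\le m$. -/

import Mathlib

open MeasureTheory

/-- A Brascamp-Lieb datum on `ℝⁿ` of length `m`: positive numbers `c i` and surjective linear
maps `B i : ℝⁿ → ℝ^(d i)`. -/
structure BLDatum (n m : ℕ) where
  /-- the exponents -/
  c : Fin m → ℝ
  /-- the dimensions of the target spaces -/
  d : Fin m → ℕ
  /-- the linear maps -/
  B : ∀ i, EuclideanSpace ℝ (Fin n) →ₗ[ℝ] EuclideanSpace ℝ (Fin (d i))
  c_pos : ∀ i, 0 < c i
  B_surjective : ∀ i, Function.Surjective (B i)

namespace BLDatum

variable {n m : ℕ}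

/-- The matrix of `B i` in the standard bases. -/
noncomputable def mat (D : BLDatum n m) (i : Fin m) : Matrix (Fin (D.d i)) (Fin n) ℝ :=
  Matrix.toEuclideanLin.symm (D.B i)

/-- The matrix `B i * A * (B i)^*`. -/
noncomputable def push (D : BLDatum n m) (A : Matrix (Fin n) (Fin n) ℝ) (i : Fin m) :
    Matrix (Fin (D.d i)) (Fin (D.d i)) ℝ :=
  D.mat i * A * (D.mat i).transpose

/-- The integrand `∏ i, (f i ∘ B i) ^ (c i)` of the Brascamp-Lieb inequality. -/
noncomputable def integrand (D : BLDatum n m) (f : ∀ i, EuclideanSpace ℝ (Fin (D.d i)) → ℝ)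
    (x : EuclideanSpace ℝ (Fin n)) : ℝ :=
  ∏ i, f i (D.B i x) ^ D.c i

/-- The Brascamp-Lieb inequality holds with the real constant `C`: for all non-negative integrable
`f i`, the integral on the left-hand side is finite and at most the right-hand side. -/
def InequalityHolds (D : BLDatum n m) (C : ℝ) : Prop :=
  ∀ f : ∀ i, EuclideanSpace ℝ (Fin (D.d i)) → ℝ,
    (∀ i x, 0 ≤ f i x) → (∀ i, Integrable (f i)) →
      Integrable (D.integrand f) ∧
        ∫ x, D.integrand f x ≤ C * ∏ i, (∫ y, f i y) ^ D.c i

/-- `C` is the Brascamp-Lieb constant: the smallest real number for which the inequality holds. -/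
def IsConstant (D : BLDatum n m) (C : ℝ) : Prop :=
  IsLeast {C' : ℝ | D.InequalityHolds C'} C

/-- The centered Gaussian functions `x ↦ exp (-⟨(B i A (B i)^*)⁻¹ x, x⟩ / 2)`. -/
noncomputable def gaussian (D : BLDatum n m) (A : Matrix (Fin n) (Fin n) ℝ) (i : Fin m)
    (x : EuclideanSpace ℝ (Fin (D.d i))) : ℝ :=
  Real.exp (-(inner ℝ (Matrix.toEuclideanLin (D.push A i)⁻¹ x) x) / 2)

end BLDatum

/-!
# The Brascamp-Lieb constant of a datum with a Gaussian critical point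

The symmetric square roots `R` of `A` and `S i` of `B i A (B i)^*` give linear changes of variables
after which the datum consists of coisometries `Q i = (S i)⁻¹ (B i) R` with
`∑ i, c i * ‖Q i x‖ ^ 2 = ‖x‖ ^ 2`; this is what the equation for `A⁻¹` says
(`BLDatum.exists_geometric`). The Jacobians produce the constant, and the Gaussian functions of the
statement become `exp (-‖y‖ ^ 2 / 2)`, for which equality is a computation. It remains to prove the
inequality for such a geometric datum with constant `1` (`integral_prod_rpow_le_of_geometric`).
Dividing every function by the standard Gaussian density turns it into
`E ∏ i, f i (Q i X) ^ c i ≤ ∏ i, (E f i (Q i X)) ^ c i` for a standard Gaussian vector `X`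
(`integral_stdGaussian_prod_rpow_le`).

The Gaussian form is proved by a discrete heat flow, without differential equations. Let
`φ i = f i ∘ Q i` be bounded between positive constants, with a first-order Taylor expansion with
quadratic remainder (`IsTame`). For a Gaussian increment `h` of variance `t`, expand
`∏ i, φ i (x + h) ^ c i` to second order in the relative increments of the `φ i`. The part up to
first order has an expectation that agrees with `∏ i, (E φ i (x + h)) ^ c i` up to `O(t ^ 2)`. The part
of second order has an expectation of `∏ i, φ i x ^ c i` times `t / 2` times
`‖∑ i, c i • w i‖ ^ 2 - ∑ i, c i * ‖w i‖ ^ 2`, up to `O(t ^ (3 / 2))`, where `w i`, the gradient of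
`log (φ i)`, lies in the range of `(Q i)^*`, and this difference is at most `0`
(`norm_sum_smul_sq_le_of_mem_range_adjoint`). So the inequality holds at
time `t` up to an error `O(t ^ (3 / 2))`, uniformly over a class of functions that is stable under
averaging (`IsTame.exists_integral_prod_rpow_le_add`). By the semigroup property of Gaussian
measures, `N` steps of length `1 / N` lead to time `1` with a total error `O(N ^ (-1 / 2))`, and
`N → ∞` removes it (`IsTame.integral_prod_rpow_le`). General integrable `f i` follow by density of
smooth functions in `L¹` and Fatou's lemma.
-/

open ProbabilityTheory Filter Topology
open scoped RealInnerProductSpace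

/-! ### The Gaussian heat semigroup -/

section HeatMeasure

variable {E : Type*} [NormedAddCommGroup E] [InnerProductSpace ℝ E] [FiniteDimensional ℝ E]
  [MeasurableSpace E] [BorelSpace E]

variable (E) in
/-- The centered Gaussian measure on `E` with covariance `t` times the identity: the heat kernel at
time `t / 2`. It is meant for `0 ≤ t`. -/
noncomputable def heatMeasure (t : ℝ) : Measure E :=
  (stdGaussian E).map (fun x => √t • x)

instance (t : ℝ) : IsProbabilityMeasure (heatMeasure E t) :=
  Measure.isProbabilityMeasure_map (by fun_prop)

omit [BorelSpace E] in
lemma heatMeasure_one : heatMeasure E 1 = stdGaussian E := by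
  simp [heatMeasure]

lemma heatMeasure_zero : heatMeasure E 0 = Measure.dirac 0 := by
  simp [heatMeasure]

lemma charFun_heatMeasure {t : ℝ} (ht : 0 ≤ t) (x : E) :
    charFun (heatMeasure E t) x = Complex.exp (-(t * ‖x‖ ^ 2) / 2) := by
  rw [heatMeasure, charFun_map_smul, charFun_stdGaussian, norm_smul, Real.norm_eq_abs,
    abs_of_nonneg (Real.sqrt_nonneg t)]
  push_cast
  rw [mul_pow, ← Complex.ofReal_pow (√t), Real.sq_sqrt ht]

/-- The semigroup property of the heat flow. -/
lemma heatMeasure_conv {s t : ℝ} (hs : 0 ≤ s) (ht : 0 ≤ t) :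
    heatMeasure E s ∗ heatMeasure E t = heatMeasure E (s + t) := by
  apply Measure.ext_of_charFun
  ext x
  rw [charFun_conv, charFun_heatMeasure hs, charFun_heatMeasure ht,
    charFun_heatMeasure (add_nonneg hs ht), ← Complex.exp_add]
  push_cast
  ring_nf

lemma integral_heatMeasure {G : Type*} [NormedAddCommGroup G] [NormedSpace ℝ G] (t : ℝ)
    {f : E → G} (hf : Continuous f) :
    ∫ y, f y ∂(heatMeasure E t) = ∫ z, f (√t • z) ∂(stdGaussian E) := by
  rw [heatMeasure, integral_map (by fun_prop) hf.aestronglyMeasurable]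

omit [InnerProductSpace ℝ E] [FiniteDimensional ℝ E] in
lemma Continuous.integrable_of_norm_le [SecondCountableTopology E] {G : Type*}
    [NormedAddCommGroup G] {f : E → G} (hf : Continuous f) (μ : Measure E) [IsFiniteMeasure μ]
    {C : ℝ} (h : ∀ x, ‖f x‖ ≤ C) : Integrable f μ :=
  Integrable.of_bound hf.aestronglyMeasurable C (Eventually.of_forall h)

lemma integral_heatMeasure_add {s t : ℝ} (hs : 0 ≤ s) (ht : 0 ≤ t) {f : E → ℝ}
    (hf : Continuous f) {C : ℝ} (hC : ∀ x, |f x| ≤ C) :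
    ∫ y, f y ∂(heatMeasure E (s + t)) =
      ∫ z, ∫ y, f (z + y) ∂(heatMeasure E t) ∂(heatMeasure E s) := by
  rw [← heatMeasure_conv hs ht, integral_conv]
  exact hf.integrable_of_norm_le _ hC

lemma integrable_norm_pow_stdGaussian (k : ℕ) :
    Integrable (fun x : E => ‖x‖ ^ k) (stdGaussian E) := by
  have := (IsGaussian.memLp_id (stdGaussian E) k (by simp)).integrable_norm_pow'
  simpa using this

lemma integral_inner_stdGaussian (v : E) : ∫ x, ⟪v, x⟫ ∂(stdGaussian E) = 0 := by
  simpa using integral_strongDual_stdGaussian (innerSL ℝ v)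

lemma integral_inner_sq_stdGaussian (v : E) : ∫ x, ⟪v, x⟫ ^ 2 ∂(stdGaussian E) = ‖v‖ ^ 2 := by
  have h := variance_dual_stdGaussian (innerSL ℝ v)
  rw [variance_of_integral_eq_zero (by fun_prop) (integral_strongDual_stdGaussian _)] at h
  simpa using h

lemma integrable_inner_stdGaussian (v : E) : Integrable (fun x => ⟪v, x⟫) (stdGaussian E) :=
  IsGaussian.integrable_dual _ (innerSL ℝ v)

lemma integrable_inner_sq_stdGaussian (v : E) :
    Integrable (fun x => ⟪v, x⟫ ^ 2) (stdGaussian E) :=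
  (IsGaussian.memLp_dual (stdGaussian E) (innerSL ℝ v) 2 (by simp)).integrable_sq

end HeatMeasure

/-! ### Taylor estimates for weighted products -/

section Scalar

variable {ι : Type*} [Fintype ι]

lemma log_one_add_le_taylor {r : ℝ} (hr : -1 < r) :
    Real.log (1 + r) ≤ r - r ^ 2 / 2 + r ^ 3 / 3 := by
  -- the difference has derivative `x ^ 3 / (1 + x)`, hence a minimum at `0`
  set F : ℝ → ℝ := fun x => x - x ^ 2 / 2 + x ^ 3 / 3 - Real.log (1 + x) with hF
  have hd : ∀ x, -1 < x → HasDerivAt F (x ^ 3 / (1 + x)) x := by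
    intro x hx
    have h1 : (1 : ℝ) + x ≠ 0 := by linarith
    have := ((((hasDerivAt_id x).sub (((hasDerivAt_id x).pow 2).div_const 2)).add
      (((hasDerivAt_id x).pow 3).div_const 3)).sub (((hasDerivAt_id x).const_add 1).log h1))
    refine this.congr_deriv ?_
    simp only [id]
    field_simp
    ring
  have h0 : F 0 = 0 := by simp [hF]
  suffices 0 ≤ F r by simp only [hF] at this; linarith
  rcases le_total 0 r with h | h
  · have : MonotoneOn F (Set.Ici 0) := by
      refine monotoneOn_of_deriv_nonneg (convex_Ici 0) ?_ ?_ ?_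
      · exact fun x hx => (hd x (by linarith [Set.mem_Ici.1 hx])).continuousAt.continuousWithinAt
      · intro x hx
        rw [interior_Ici] at hx
        exact (hd x (by linarith [Set.mem_Ioi.1 hx])).differentiableAt.differentiableWithinAt
      · intro x hx
        rw [interior_Ici, Set.mem_Ioi] at hx
        rw [(hd x (by linarith)).deriv]
        positivity
    rw [← h0]
    exact this (Set.mem_Ici.2 le_rfl) h h
  · have : AntitoneOn F (Set.Ioc (-1) 0) := by
      refine antitoneOn_of_deriv_nonpos (convex_Ioc _ _) ?_ ?_ ?_
      · exact fun x hx => (hd x hx.1).continuousAt.continuousWithinAt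
      · intro x hx
        rw [interior_Ioc] at hx
        exact (hd x hx.1).differentiableAt.differentiableWithinAt
      · intro x hx
        rw [interior_Ioc] at hx
        rw [(hd x hx.1).deriv]
        have h1 : 0 < 1 + x := by linarith [hx.1]
        have h3 : x ^ 3 ≤ 0 := Odd.pow_nonpos (by decide) hx.2.le
        exact div_nonpos_of_nonpos_of_nonneg h3 h1.le
    rw [← h0]
    exact this ⟨hr, h⟩ ⟨by norm_num, le_rfl⟩ h

lemma exp_le_taylor (b : ℝ) : Real.exp b ≤ 1 + b + b ^ 2 / 2 + |b| ^ 3 * Real.exp |b| := by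
  have h := Complex.norm_exp_sub_sum_le_norm_mul_exp (b : ℂ) 3
  have h2 : Complex.exp (b : ℂ) - ∑ m ∈ Finset.range 3, (b : ℂ) ^ m / (m.factorial : ℂ) =
      ((Real.exp b - (1 + b + b ^ 2 / 2) : ℝ) : ℂ) := by
    simp [Finset.sum_range_succ]
  rw [h2, Complex.norm_real, Complex.norm_real, Real.norm_eq_abs, Real.norm_eq_abs] at h
  linarith [le_abs_self (Real.exp b - (1 + b + b ^ 2 / 2))]

lemma abs_sum_mul_le_of_abs_le {c r : ι → ℝ} (hc : ∀ i, 0 ≤ c i) {t : ℝ} (h : ∀ i, |r i| ≤ t) :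
    |∑ i, c i * r i| ≤ (∑ i, c i) * t := by
  refine (Finset.abs_sum_le_sum_abs _ _).trans ?_
  rw [Finset.sum_mul]
  refine Finset.sum_le_sum fun i _ => ?_
  rw [abs_mul, abs_of_nonneg (hc i)]
  exact mul_le_mul_of_nonneg_left (h i) (hc i)

/-- Second-order Taylor expansion of `∏ i, (1 + r i) ^ c i` from above, with a cubic error that is
uniform for bounded `r`. -/
lemma exists_prod_one_add_rpow_le (c : ι → ℝ) (hc : ∀ i, 0 ≤ c i) {T : ℝ} (hT : 0 ≤ T) :
    ∃ K, 0 ≤ K ∧ ∀ (r : ι → ℝ) (t : ℝ), (∀ i, -1 < r i) → (∀ i, |r i| ≤ t) → 0 ≤ t → t ≤ T →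
      ∏ i, (1 + r i) ^ c i ≤ 1 + ∑ i, c i * r i +
        ((∑ i, c i * r i) ^ 2 - ∑ i, c i * r i ^ 2) / 2 + K * t ^ 3 := by
  set S := ∑ i, c i with hS
  have hS0 : 0 ≤ S := Finset.sum_nonneg fun i _ => hc i
  set D := S * (1 + T + T ^ 2) with hD
  have hD0 : 0 ≤ D := by positivity
  refine ⟨S + D * (S * (1 + T)) + D ^ 3 * Real.exp (D * T), by positivity, ?_⟩
  intro r t hr hrt ht htT
  set a := ∑ i, c i * r i
  set q := ∑ i, c i * r i ^ 2
  set s := ∑ i, c i * r i ^ 3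
  have ha : |a| ≤ S * t := abs_sum_mul_le_of_abs_le hc hrt
  have hq : |q| ≤ S * t ^ 2 := abs_sum_mul_le_of_abs_le hc fun i => by
    rw [abs_pow]; exact pow_le_pow_left₀ (abs_nonneg _) (hrt i) 2
  have hs : |s| ≤ S * t ^ 3 := abs_sum_mul_le_of_abs_le hc fun i => by
    rw [abs_pow]; exact pow_le_pow_left₀ (abs_nonneg _) (hrt i) 3
  set b := a - q / 2 + s / 3 with hb
  have h1 : ∏ i, (1 + r i) ^ c i ≤ Real.exp b := by
    have hbs : b = ∑ i, c i * (r i - r i ^ 2 / 2 + r i ^ 3 / 3) := by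
      simp only [hb, a, q, s, Finset.sum_div, ← Finset.sum_sub_distrib, ← Finset.sum_add_distrib]
      exact Finset.sum_congr rfl fun i _ => by ring
    rw [hbs, Real.exp_sum]
    refine Finset.prod_le_prod (fun i _ => Real.rpow_nonneg (by linarith [hr i]) _) fun i _ => ?_
    rw [Real.rpow_def_of_pos (by linarith [hr i]), Real.exp_le_exp, mul_comm]
    exact mul_le_mul_of_nonneg_left (log_one_add_le_taylor (hr i)) (hc i)
  have hSt2 : S * t ^ 2 ≤ S * T * t := by nlinarith [mul_nonneg hS0 ht]
  have hSt3 : S * t ^ 3 ≤ S * T * t ^ 2 := by nlinarith [mul_nonneg hS0 (sq_nonneg t)]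
  have hSt3' : S * T * t ^ 2 ≤ S * T ^ 2 * t := by
    nlinarith [mul_nonneg (mul_nonneg hS0 hT) ht]
  have hSt0 : 0 ≤ S * t := by positivity
  have hSTt0 : 0 ≤ S * T * t := by positivity
  have hST2t0 : 0 ≤ S * T ^ 2 * t := by positivity
  have hSt20 : 0 ≤ S * t ^ 2 := by positivity
  have hSTt20 : 0 ≤ S * T * t ^ 2 := by positivity
  rw [abs_le] at ha hq hs
  have hDt : D * t = S * t + S * T * t + S * T ^ 2 * t := by rw [hD]; ring
  have hbt : |b| ≤ D * t := by rw [abs_le, hDt]; constructor <;> linarith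
  have hba : |b - a| ≤ S * (1 + T) * t ^ 2 := by
    rw [abs_le, show S * (1 + T) * t ^ 2 = S * t ^ 2 + S * T * t ^ 2 by ring]
    constructor <;> linarith
  have hba' : |b + a| ≤ 2 * (D * t) := by
    have := abs_le.1 hbt
    rw [abs_le]; constructor <;> linarith
  have hsq : b ^ 2 - a ^ 2 ≤ S * (1 + T) * t ^ 2 * (2 * (D * t)) := by
    calc b ^ 2 - a ^ 2 = (b - a) * (b + a) := by ring
      _ ≤ |(b - a) * (b + a)| := le_abs_self _
      _ = |b - a| * |b + a| := abs_mul _ _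
      _ ≤ _ := mul_le_mul hba hba' (abs_nonneg _) (by positivity)
  have hcub : |b| ^ 3 * Real.exp |b| ≤ (D * t) ^ 3 * Real.exp (D * T) := by
    refine mul_le_mul (pow_le_pow_left₀ (abs_nonneg _) hbt 3) (Real.exp_le_exp.2 ?_)
      (Real.exp_nonneg _) (by positivity)
    exact hbt.trans (mul_le_mul_of_nonneg_left htT hD0)
  have hSt30 : 0 ≤ S * t ^ 3 := by positivity
  have := exp_le_taylor b
  calc ∏ i, (1 + r i) ^ c i ≤ 1 + b + b ^ 2 / 2 + (D * t) ^ 3 * Real.exp (D * T) := by linarith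
    _ ≤ 1 + a + (a ^ 2 - q) / 2 + S * t ^ 3 + S * (1 + T) * t ^ 2 * (D * t) +
        (D * t) ^ 3 * Real.exp (D * T) := by rw [hb] at hsq ⊢; linarith
    _ = _ := by ring

/-- First-order lower bound for `∏ i, (1 + e i) ^ c i`, with a quadratic error. -/
lemma le_prod_one_add_rpow {c e : ι → ℝ} (hc : ∀ i, 0 ≤ c i) {ρ : ℝ} (hρ : 0 < ρ)
    (he : ∀ i, ρ ≤ 1 + e i) :
    1 + ∑ i, c i * e i - (∑ i, c i * e i ^ 2) / ρ ≤ ∏ i, (1 + e i) ^ c i := by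
  have h1 : ∀ i, e i - e i ^ 2 / ρ ≤ Real.log (1 + e i) := by
    intro i
    have hpos : 0 < 1 + e i := hρ.trans_le (he i)
    have h2 := Real.one_sub_inv_le_log_of_pos hpos
    have h3 : e i ^ 2 / (1 + e i) ≤ e i ^ 2 / ρ :=
      div_le_div_of_nonneg_left (sq_nonneg _) hρ (he i)
    have h4 : 1 - (1 + e i)⁻¹ = e i - e i ^ 2 / (1 + e i) := by field_simp; ring
    linarith
  calc 1 + ∑ i, c i * e i - (∑ i, c i * e i ^ 2) / ρ
      = ∑ i, c i * (e i - e i ^ 2 / ρ) + 1 := by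
        rw [Finset.sum_div, add_sub_assoc, ← Finset.sum_sub_distrib, add_comm]
        congr 1
        exact Finset.sum_congr rfl fun i _ => by ring
    _ ≤ ∑ i, c i * Real.log (1 + e i) + 1 := by
        gcongr with i
        · exact hc i
        · exact h1 i
    _ ≤ Real.exp (∑ i, c i * Real.log (1 + e i)) := Real.add_one_le_exp _
    _ = ∏ i, (1 + e i) ^ c i := by
        rw [Real.exp_sum]
        refine Finset.prod_congr rfl fun i _ => ?_
        rw [Real.rpow_def_of_pos (hρ.trans_le (he i)), mul_comm]

end Scalar

/-! ### One step of the heat flow -/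

section Step

variable {E : Type*} [NormedAddCommGroup E] [InnerProductSpace ℝ E]

/-- `φ` is a continuous function with values in `[ε, M]` and `p` is a continuous gradient for it,
taking values in the subspace `W`; `φ` is `K`-Lipschitz, `p` is bounded by `K`, and the first-order
Taylor expansion of `φ` has a remainder of at most `K ‖h‖ ^ 2`. No differentiability is required,
so that the class is visibly stable under averaging over translations. -/
structure IsTame (W : Submodule ℝ E) (ε M K : ℝ) (φ : E → ℝ) (p : E → E) : Prop where
  continuous : Continuous φ
  continuous_grad : Continuous p
  le : ∀ x, ε ≤ φ x
  le' : ∀ x, φ x ≤ M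
  lipschitz : ∀ x h, |φ (x + h) - φ x| ≤ K * ‖h‖
  norm_grad_le : ∀ x, ‖p x‖ ≤ K
  grad_mem : ∀ x, p x ∈ W
  taylor : ∀ x h, |φ (x + h) - φ x - ⟪p x, h⟫| ≤ K * ‖h‖ ^ 2

variable {ι : Type*} [Fintype ι]

/-- The pointwise form of the heat flow step: the increment of `∏ i, φ i ^ c i` is controlled by the
increments of the `φ i` and a quadratic form in the logarithmic gradients, up to a cubic error that
is uniform over the class `IsTame`. -/
lemma IsTame.exists_prod_rpow_add_le (c : ι → ℝ) (hc : ∀ i, 0 ≤ c i) (W : ι → Submodule ℝ E)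
    {ε M K : ℝ} (hε : 0 < ε) (hM : 0 ≤ M) (hK : 0 ≤ K) :
    ∃ C, 0 ≤ C ∧ ∀ (φ : ι → E → ℝ) (p : ι → E → E), (∀ i, IsTame (W i) ε M K (φ i) (p i)) →
      ∀ x h, ∏ i, φ i (x + h) ^ c i ≤ (∏ i, φ i x ^ c i) *
        (1 + ∑ i, c i * (φ i (x + h) / φ i x - 1) +
          (⟪∑ i, c i • (φ i x)⁻¹ • p i x, h⟫ ^ 2 -
            ∑ i, c i * ⟪(φ i x)⁻¹ • p i x, h⟫ ^ 2) / 2) + C * ‖h‖ ^ 3 := by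
  set L := K / ε with hL
  have hL0 : 0 ≤ L := by positivity
  obtain ⟨C₀, hC₀, hT⟩ := exists_prod_one_add_rpow_le c hc (T := M / ε + 1) (by positivity)
  set S := ∑ i, c i with hS
  have hS0 : 0 ≤ S := Finset.sum_nonneg fun i _ => hc i
  set C₁ := C₀ * L ^ 3 + S * L * (S * (2 * L)) + S * (L * (2 * L)) with hC₁
  refine ⟨(∏ i, M ^ c i) * C₁, by positivity, ?_⟩
  intro φ p hφ x h
  have hpos : ∀ i y, 0 < φ i y := fun i y => hε.trans_le ((hφ i).le y)
  have hinv : ∀ i, (φ i x)⁻¹ ≤ ε⁻¹ := fun i => inv_anti₀ hε ((hφ i).le x)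
  set r : ι → ℝ := fun i => φ i (x + h) / φ i x - 1 with hr
  set u : ι → ℝ := fun i => ⟪(φ i x)⁻¹ • p i x, h⟫ with hu
  have hr' : ∀ i, r i = (φ i x)⁻¹ * (φ i (x + h) - φ i x) := fun i => by
    have := (hpos i x).ne'
    simp only [hr]; field_simp
  have hu' : ∀ i, u i = (φ i x)⁻¹ * ⟪p i x, h⟫ := fun i => by simp [hu, real_inner_smul_left]
  have hinv0 : ∀ i, 0 ≤ (φ i x)⁻¹ := fun i => (inv_pos.2 (hpos i x)).le
  have scale : ∀ i (a b : ℝ), |a| ≤ K * b → |(φ i x)⁻¹ * a| ≤ L * b := by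
    intro i a b hab
    rw [abs_mul, abs_of_nonneg (hinv0 i)]
    calc (φ i x)⁻¹ * |a| ≤ ε⁻¹ * |a| := mul_le_mul_of_nonneg_right (hinv i) (abs_nonneg _)
      _ ≤ ε⁻¹ * (K * b) := mul_le_mul_of_nonneg_left hab (inv_pos.2 hε).le
      _ = L * b := by rw [hL]; ring
  have hr1 : ∀ i, |r i| ≤ L * ‖h‖ := fun i => by
    rw [hr']; exact scale i _ _ ((hφ i).lipschitz x h)
  have hu1 : ∀ i, |u i| ≤ L * ‖h‖ := fun i => by
    rw [hu']
    refine scale i _ _ ((abs_real_inner_le_norm _ _).trans ?_)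
    exact mul_le_mul_of_nonneg_right ((hφ i).norm_grad_le x) (norm_nonneg _)
  have hru : ∀ i, |r i - u i| ≤ L * ‖h‖ ^ 2 := fun i => by
    rw [hr', hu', ← mul_sub]; exact scale i _ _ ((hφ i).taylor x h)
  have hrT : ∀ i, |r i| ≤ M / ε + 1 := fun i => by
    have h1 : 0 ≤ φ i (x + h) / φ i x := (div_pos (hpos i _) (hpos i _)).le
    have h2 : φ i (x + h) / φ i x ≤ M / ε :=
      div_le_div₀ hM ((hφ i).le' _) hε ((hφ i).le x)
    have h3 : 0 ≤ M / ε := by positivity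
    rw [abs_le]; constructor <;> simp only [hr] <;> linarith
  have hr2 : ∀ i, -1 < r i := fun i => by
    have h1 : 0 < φ i (x + h) / φ i x := div_pos (hpos i _) (hpos i _)
    simp only [hr]; linarith
  have hmain := hT r (min (L * ‖h‖) (M / ε + 1)) hr2 (fun i => le_min (hr1 i) (hrT i))
    (by positivity) (min_le_right _ _)
  have hmin : min (L * ‖h‖) (M / ε + 1) ^ 3 ≤ (L * ‖h‖) ^ 3 :=
    pow_le_pow_left₀ (by positivity) (min_le_left _ _) 3
  -- replacing `r` by its linear part `u` in the quadratic terms costs a cubic error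
  have hq1 : (∑ i, c i * r i) ^ 2 - (∑ i, c i * u i) ^ 2 ≤
      S * (L * ‖h‖ ^ 2) * (S * (2 * L * ‖h‖)) := by
    have e1 : ∑ i, c i * r i - ∑ i, c i * u i = ∑ i, c i * (r i - u i) := by
      rw [← Finset.sum_sub_distrib]; exact Finset.sum_congr rfl fun i _ => by ring
    have e2 : ∑ i, c i * r i + ∑ i, c i * u i = ∑ i, c i * (r i + u i) := by
      rw [← Finset.sum_add_distrib]; exact Finset.sum_congr rfl fun i _ => by ring
    have h1 := abs_sum_mul_le_of_abs_le hc hru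
    have h2 : |∑ i, c i * (r i + u i)| ≤ S * (2 * L * ‖h‖) := abs_sum_mul_le_of_abs_le hc fun i =>
      (abs_add_le _ _).trans (by linarith [hr1 i, hu1 i])
    calc _ = (∑ i, c i * (r i - u i)) * (∑ i, c i * (r i + u i)) := by rw [← e1, ← e2]; ring
      _ ≤ |(∑ i, c i * (r i - u i)) * (∑ i, c i * (r i + u i))| := le_abs_self _
      _ ≤ _ := by rw [abs_mul]; exact mul_le_mul h1 h2 (abs_nonneg _) (by positivity)
  have hq2 : ∑ i, c i * u i ^ 2 - ∑ i, c i * r i ^ 2 ≤ S * (L * ‖h‖ ^ 2 * (2 * L * ‖h‖)) := by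
    have e1 : ∑ i, c i * u i ^ 2 - ∑ i, c i * r i ^ 2 = ∑ i, c i * ((u i - r i) * (u i + r i)) := by
      rw [← Finset.sum_sub_distrib]; exact Finset.sum_congr rfl fun i _ => by ring
    rw [e1]
    refine (le_abs_self _).trans (abs_sum_mul_le_of_abs_le hc fun i => ?_)
    rw [abs_mul]
    refine mul_le_mul (by rw [abs_sub_comm]; exact hru i) ((abs_add_le _ _).trans ?_)
      (abs_nonneg _) (by positivity)
    linarith [hr1 i, hu1 i]
  have hP : ∏ i, φ i (x + h) ^ c i = (∏ i, φ i x ^ c i) * ∏ i, (1 + r i) ^ c i := by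
    rw [← Finset.prod_mul_distrib]
    refine Finset.prod_congr rfl fun i _ => ?_
    rw [← Real.mul_rpow (hpos i x).le (by linarith [hr2 i])]
    congr 1
    have := (hpos i x).ne'
    simp only [hr]; field_simp; ring
  have hP0 : 0 ≤ ∏ i, φ i x ^ c i :=
    Finset.prod_nonneg fun i _ => Real.rpow_nonneg (hpos i x).le _
  have hPM : ∏ i, φ i x ^ c i ≤ ∏ i, M ^ c i :=
    Finset.prod_le_prod (fun i _ => Real.rpow_nonneg (hpos i x).le _)
      fun i _ => Real.rpow_le_rpow (hpos i x).le ((hφ i).le' x) (hc i)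
  have hsum : ⟪∑ i, c i • (φ i x)⁻¹ • p i x, h⟫ = ∑ i, c i * u i := by
    simp only [sum_inner, real_inner_smul_left, hu]
  rw [hP, hsum]
  have hfinal : ∏ i, (1 + r i) ^ c i ≤ 1 + ∑ i, c i * r i +
      ((∑ i, c i * u i) ^ 2 - ∑ i, c i * u i ^ 2) / 2 + C₁ * ‖h‖ ^ 3 := by
    have h1 : C₀ * min (L * ‖h‖) (M / ε + 1) ^ 3 ≤ C₀ * (L * ‖h‖) ^ 3 :=
      mul_le_mul_of_nonneg_left hmin hC₀
    have h2 : C₁ * ‖h‖ ^ 3 = C₀ * (L * ‖h‖) ^ 3 + S * (L * ‖h‖ ^ 2) * (S * (2 * L * ‖h‖)) +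
        S * (L * ‖h‖ ^ 2 * (2 * L * ‖h‖)) := by rw [hC₁]; ring
    have h3 : 0 ≤ S * (L * ‖h‖ ^ 2) * (S * (2 * L * ‖h‖)) := by positivity
    have h4 : 0 ≤ S * (L * ‖h‖ ^ 2 * (2 * L * ‖h‖)) := by positivity
    linarith
  have hC₁0 : 0 ≤ C₁ := by positivity
  calc _ ≤ (∏ i, φ i x ^ c i) * (1 + ∑ i, c i * r i +
      ((∑ i, c i * u i) ^ 2 - ∑ i, c i * u i ^ 2) / 2 + C₁ * ‖h‖ ^ 3) :=
        mul_le_mul_of_nonneg_left hfinal hP0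
    _ ≤ _ := by
      rw [mul_add, mul_assoc (∏ i, M ^ c i)]
      gcongr

lemma IsTame.abs_le {W : Submodule ℝ E} {ε M K : ℝ} {φ : E → ℝ} {p : E → E} (hε : 0 ≤ ε)
    (h : IsTame W ε M K φ p) (x : E) : |φ x| ≤ M := by
  rw [abs_of_nonneg (hε.trans (h.le x))]; exact h.le' x

lemma IsTame.continuous_prod_rpow {W : ι → Submodule ℝ E} {ε M K : ℝ} {φ : ι → E → ℝ}
    {p : ι → E → E} {c : ι → ℝ} (hc : ∀ i, 0 ≤ c i) (h : ∀ i, IsTame (W i) ε M K (φ i) (p i)) :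
    Continuous fun x => ∏ i, φ i x ^ c i :=
  continuous_finsetProd _ fun i _ => (h i).continuous.rpow_const fun _ => Or.inr (hc i)

lemma IsTame.abs_prod_rpow_le {W : ι → Submodule ℝ E} {ε M K : ℝ} (hε : 0 ≤ ε) {φ : ι → E → ℝ}
    {p : ι → E → E} {c : ι → ℝ} (hc : ∀ i, 0 ≤ c i) (h : ∀ i, IsTame (W i) ε M K (φ i) (p i))
    (x : E) : |∏ i, φ i x ^ c i| ≤ ∏ i, M ^ c i := by
  rw [Finset.abs_prod]
  refine Finset.prod_le_prod (fun i _ => abs_nonneg _) fun i _ => ?_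
  rw [abs_of_nonneg (Real.rpow_nonneg (hε.trans ((h i).le x)) _)]
  exact Real.rpow_le_rpow (hε.trans ((h i).le x)) ((h i).le' x) (hc i)

variable [FiniteDimensional ℝ E] [MeasurableSpace E] [BorelSpace E]

/-- The class `IsTame` is stable under averaging over translations. -/
lemma IsTame.average {W : Submodule ℝ E} {ε M K : ℝ} {φ : E → ℝ} {p : E → E} (hε : 0 ≤ ε)
    (h : IsTame W ε M K φ p) (μ : Measure E) [IsProbabilityMeasure μ] :
    IsTame W ε M K (fun x => ∫ y, φ (x + y) ∂μ) (fun x => ∫ y, p (x + y) ∂μ) := by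
  have hcφ : ∀ x, Continuous fun y => φ (x + y) := fun x => h.continuous.comp (by fun_prop)
  have hcp : ∀ x, Continuous fun y => p (x + y) := fun x => h.continuous_grad.comp (by fun_prop)
  have hiφ : ∀ x, Integrable (fun y => φ (x + y)) μ := fun x =>
    (hcφ x).integrable_of_norm_le μ fun y => h.abs_le hε _
  have hip : ∀ x, Integrable (fun y => p (x + y)) μ := fun x =>
    (hcp x).integrable_of_norm_le μ fun y => h.norm_grad_le _
  have hmean : ∀ (f : E → ℝ) (C : ℝ), (∀ y, |f y| ≤ C) → |∫ y, f y ∂μ| ≤ C := by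
    intro f C hf
    simpa using norm_integral_le_of_norm_le_const (f := f) (C := C) (μ := μ)
      (Eventually.of_forall hf)
  refine ⟨?_, ?_, ?_, ?_, ?_, ?_, ?_, ?_⟩
  · exact continuous_of_dominated (bound := fun _ => M) (fun x => (hcφ x).aestronglyMeasurable)
      (fun x => Eventually.of_forall fun y => h.abs_le hε _) (integrable_const _)
      (Eventually.of_forall fun y => h.continuous.comp (by fun_prop))
  · exact continuous_of_dominated (bound := fun _ => K) (fun x => (hcp x).aestronglyMeasurable)
      (fun x => Eventually.of_forall fun y => h.norm_grad_le _) (integrable_const _)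
      (Eventually.of_forall fun y => h.continuous_grad.comp (by fun_prop))
  · intro x
    simpa using integral_mono (integrable_const ε) (hiφ x) fun y => h.le _
  · intro x
    simpa using integral_mono (hiφ x) (integrable_const M) fun y => h.le' _
  · intro x k
    rw [← integral_sub (hiφ _) (hiφ _)]
    refine hmean _ _ fun y => ?_
    rw [add_right_comm]; exact h.lipschitz _ _
  · intro x
    simpa using norm_integral_le_of_norm_le_const (μ := μ)
      (Eventually.of_forall fun y => h.norm_grad_le (x + y))
  · intro x
    exact W.convex.integral_mem (Submodule.closed_of_finiteDimensional W)
      (Eventually.of_forall fun y => h.grad_mem _) (hip x)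
  · intro x k
    have h1 : ⟪∫ y, p (x + y) ∂μ, k⟫ = ∫ y, ⟪p (x + y), k⟫ ∂μ := by
      rw [real_inner_comm, ← integral_inner (hip x)]
      simp_rw [real_inner_comm]
    have h2 : Integrable (fun y => φ (x + k + y) - φ (x + y)) μ := (hiφ _).sub (hiφ _)
    rw [h1, ← integral_sub (hiφ _) (hiφ _), ← integral_sub h2 ((hip x).inner_const k)]
    refine hmean _ _ fun y => ?_
    rw [add_right_comm]; exact h.taylor _ _

/-- One step of the heat flow: the Gaussian inequality at a small time `t` holds up to an error of
order `t ^ (3 / 2)`. The second-order term has a sign thanks to the hypothesis on the `W i`. -/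
lemma IsTame.exists_integral_prod_rpow_le_add (c : ι → ℝ) (hc : ∀ i, 0 ≤ c i)
    (W : ι → Submodule ℝ E)
    (hW : ∀ w : ι → E, (∀ i, w i ∈ W i) → ‖∑ i, c i • w i‖ ^ 2 ≤ ∑ i, c i * ‖w i‖ ^ 2)
    {ε M K : ℝ} (hε : 0 < ε) (hM : 0 < M) (hK : 0 ≤ K) :
    ∃ C, 0 ≤ C ∧ ∀ (φ : ι → E → ℝ) (p : ι → E → E), (∀ i, IsTame (W i) ε M K (φ i) (p i)) →
      ∀ t, 0 ≤ t → t ≤ 1 → ∀ x, ∫ y, ∏ i, φ i (x + y) ^ c i ∂(heatMeasure E t) ≤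
        ∏ i, (∫ y, φ i (x + y) ∂(heatMeasure E t)) ^ c i + C * √t ^ 3 := by
  obtain ⟨C₀, hC₀, hT⟩ := IsTame.exists_prod_rpow_add_le c hc W hε hM.le hK
  set m₂ := ∫ z : E, ‖z‖ ^ 2 ∂(stdGaussian E) with hm₂
  set m₃ := ∫ z : E, ‖z‖ ^ 3 ∂(stdGaussian E) with hm₃
  have hm₂0 : 0 ≤ m₂ := integral_nonneg fun z => by positivity
  have hm₃0 : 0 ≤ m₃ := integral_nonneg fun z => by positivity
  set S := ∑ i, c i with hS
  have hS0 : 0 ≤ S := Finset.sum_nonneg fun i _ => hc i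
  set B := (∏ i, M ^ c i) * (S * (K * m₂ / ε) ^ 2 / (ε / M)) with hB
  have hB0 : 0 ≤ B := by positivity
  refine ⟨B + C₀ * m₃, by positivity, ?_⟩
  intro φ p hφ t ht ht1 x
  set s := √t with hs
  have hs0 : 0 ≤ s := Real.sqrt_nonneg t
  have hs1 : s ≤ 1 := Real.sqrt_le_one.2 ht1
  have hpos : ∀ i y, 0 < φ i y := fun i y => hε.trans_le ((hφ i).le y)
  have hcont : ∀ i, Continuous fun y => φ i (x + y) := fun i =>
    (hφ i).continuous.comp (by fun_prop)
  have hint : ∀ i, Integrable (fun z => φ i (x + s • z)) (stdGaussian E) := fun i =>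
    ((hφ i).continuous.comp (by fun_prop)).integrable_of_norm_le _ fun y => (hφ i).abs_le hε.le _
  have hcprod : Continuous fun y => ∏ i, φ i (x + y) ^ c i :=
    (IsTame.continuous_prod_rpow hc hφ).comp (by fun_prop)
  rw [integral_heatMeasure t hcprod]
  simp_rw [fun i => integral_heatMeasure t (hcont i)]
  rw [← hs]
  set P := ∏ i, φ i x ^ c i with hP
  have hP0 : 0 ≤ P := Finset.prod_nonneg fun i _ => Real.rpow_nonneg (hpos i x).le _
  have hPM : P ≤ ∏ i, M ^ c i :=
    Finset.prod_le_prod (fun i _ => Real.rpow_nonneg (hpos i x).le _)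
      fun i _ => Real.rpow_le_rpow (hpos i x).le ((hφ i).le' x) (hc i)
  set I : ι → ℝ := fun i => ∫ z, φ i (x + s • z) ∂(stdGaussian E) with hI
  set e : ι → ℝ := fun i => I i / φ i x - 1 with he
  set w : ι → E := fun i => (φ i x)⁻¹ • p i x with hw
  have hstep : ∫ z, ∏ i, φ i (x + s • z) ^ c i ∂(stdGaussian E) ≤
      P * (1 + ∑ i, c i * e i + (s ^ 2 * ‖∑ i, c i • w i‖ ^ 2 -
        ∑ i, c i * (s ^ 2 * ‖w i‖ ^ 2)) / 2) + C₀ * (s ^ 3 * m₃) := by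
    have i1 : ∀ i, Integrable (fun z => c i * (φ i (x + s • z) / φ i x - 1)) (stdGaussian E) :=
      fun i => (((hint i).div_const _).sub (integrable_const _)).const_mul _
    have i2 : ∀ v : E, Integrable (fun z => (s * ⟪v, z⟫) ^ 2) (stdGaussian E) := fun v => by
      simp_rw [mul_pow]; exact (integrable_inner_sq_stdGaussian v).const_mul _
    have i3 : Integrable (fun z : E => (s * ‖z‖) ^ 3) (stdGaussian E) := by
      simp_rw [mul_pow]; exact (integrable_norm_pow_stdGaussian 3).const_mul _
    have i4 : Integrable (fun z => ∑ i, c i * (φ i (x + s • z) / φ i x - 1)) (stdGaussian E) :=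
      integrable_finsetSum _ fun i _ => i1 i
    have i5 : Integrable (fun z => ∑ i, c i * (s * ⟪w i, z⟫) ^ 2) (stdGaussian E) :=
      integrable_finsetSum _ fun i _ => (i2 _).const_mul _
    have i6 : Integrable (fun z => 1 + ∑ i, c i * (φ i (x + s • z) / φ i x - 1)) (stdGaussian E) :=
      (integrable_const _).add i4
    have i7 : Integrable (fun z => ((s * ⟪∑ i, c i • w i, z⟫) ^ 2 -
        ∑ i, c i * (s * ⟪w i, z⟫) ^ 2) / 2) (stdGaussian E) := ((i2 _).sub i5).div_const _
    have i8 : Integrable (fun z => P * (1 + ∑ i, c i * (φ i (x + s • z) / φ i x - 1) +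
        ((s * ⟪∑ i, c i • w i, z⟫) ^ 2 - ∑ i, c i * (s * ⟪w i, z⟫) ^ 2) / 2)) (stdGaussian E) :=
      (i6.add i7).const_mul P
    calc ∫ z, ∏ i, φ i (x + s • z) ^ c i ∂(stdGaussian E)
        ≤ ∫ z, P * (1 + ∑ i, c i * (φ i (x + s • z) / φ i x - 1) +
          ((s * ⟪∑ i, c i • w i, z⟫) ^ 2 - ∑ i, c i * (s * ⟪w i, z⟫) ^ 2) / 2) +
          C₀ * (s * ‖z‖) ^ 3 ∂(stdGaussian E) := by
          refine integral_mono ?_ (i8.add (i3.const_mul _)) fun z => ?_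
          · have h0 : Continuous fun z : E => ∏ i, φ i (x + s • z) ^ c i :=
              (IsTame.continuous_prod_rpow hc hφ).comp (by fun_prop)
            exact h0.integrable_of_norm_le _ fun y => IsTame.abs_prod_rpow_le hε.le hc hφ _
          · have := hT φ p hφ x (s • z)
            simpa only [real_inner_smul_right, norm_smul, Real.norm_eq_abs, abs_of_nonneg hs0]
              using this
      _ = _ := by
          rw [integral_add i8 (i3.const_mul _), integral_const_mul, integral_const_mul,
            integral_add i6 i7, integral_add (integrable_const _) i4, integral_finsetSum _
            (fun i _ => i1 i), integral_div, integral_sub (i2 _) i5, integral_finsetSum _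
            (fun i _ => (i2 _).const_mul _)]
          simp_rw [integral_const_mul, mul_pow, integral_const_mul, integral_inner_sq_stdGaussian]
          have : ∀ i, ∫ z, (φ i (x + s • z) / φ i x - 1) ∂(stdGaussian E) = e i := fun i => by
            rw [integral_sub ((hint i).div_const _) (integrable_const _), integral_div]
            simp [he, hI]
          simp_rw [this]
          simp [hm₃]
  have hwW : s ^ 2 * ‖∑ i, c i • w i‖ ^ 2 - ∑ i, c i * (s ^ 2 * ‖w i‖ ^ 2) ≤ 0 := by
    have h1 := hW w fun i => (W i).smul_mem _ ((hφ i).grad_mem x)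
    have h2 : ∑ i, c i * (s ^ 2 * ‖w i‖ ^ 2) = s ^ 2 * ∑ i, c i * ‖w i‖ ^ 2 := by
      rw [Finset.mul_sum]; exact Finset.sum_congr rfl fun i _ => by ring
    rw [h2, ← mul_sub]
    exact mul_nonpos_of_nonneg_of_nonpos (sq_nonneg s) (by linarith)
  have hIx : ∀ i, |I i - φ i x| ≤ K * (s ^ 2 * m₂) := fun i => by
    have j1 : Integrable (fun z => ⟪p i x, s • z⟫) (stdGaussian E) := by
      simp_rw [real_inner_smul_right]; exact (integrable_inner_stdGaussian _).const_mul _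
    have j2 : I i - φ i x = ∫ z, (φ i (x + s • z) - φ i x - ⟪p i x, s • z⟫) ∂(stdGaussian E) := by
      have j0 : Integrable (fun z => φ i (x + s • z) - φ i x) (stdGaussian E) :=
        (hint i).sub (integrable_const _)
      rw [integral_sub j0 j1, integral_sub (hint i) (integrable_const _)]
      simp_rw [real_inner_smul_right, integral_const_mul, integral_inner_stdGaussian]
      simp [hI]
    have j3 : Integrable (fun z : E => K * (s * ‖z‖) ^ 2) (stdGaussian E) := by
      simp_rw [mul_pow]; exact ((integrable_norm_pow_stdGaussian 2).const_mul _).const_mul _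
    rw [j2, ← Real.norm_eq_abs]
    refine (norm_integral_le_of_norm_le j3 (Eventually.of_forall fun z => ?_)).trans_eq ?_
    · have := (hφ i).taylor x (s • z)
      rwa [norm_smul, Real.norm_eq_abs, abs_of_nonneg hs0] at this
    · simp_rw [mul_pow, integral_const_mul, hm₂]
  have he2 : ∀ i, e i ^ 2 ≤ (K * m₂ / ε) ^ 2 * s ^ 3 := fun i => by
    have h1 : |e i| ≤ K * m₂ / ε * s ^ 2 := by
      have : e i = (φ i x)⁻¹ * (I i - φ i x) := by
        have := (hpos i x).ne'
        simp only [he]; field_simp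
      rw [this, abs_mul, abs_of_pos (inv_pos.2 (hpos i x))]
      calc _ ≤ ε⁻¹ * (K * (s ^ 2 * m₂)) :=
            mul_le_mul (inv_anti₀ hε ((hφ i).le x)) (hIx i) (abs_nonneg _) (inv_pos.2 hε).le
        _ = _ := by ring
    calc e i ^ 2 = |e i| ^ 2 := (sq_abs _).symm
      _ ≤ (K * m₂ / ε * s ^ 2) ^ 2 := pow_le_pow_left₀ (abs_nonneg _) h1 2
      _ = (K * m₂ / ε) ^ 2 * (s ^ 3 * s) := by ring
      _ ≤ (K * m₂ / ε) ^ 2 * (s ^ 3 * 1) := by gcongr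
      _ = _ := by ring
  have hIε : ∀ i, ε ≤ I i := fun i => by
    simpa using integral_mono (integrable_const ε) (hint i) fun y => (hφ i).le _
  have hρ : ∀ i, ε / M ≤ 1 + e i := fun i => by
    have : 1 + e i = I i / φ i x := by simp [he]
    rw [this]
    exact div_le_div₀ (hε.le.trans (hIε i)) (hIε i) (hpos i x) ((hφ i).le' x)
  have hlow := le_prod_one_add_rpow hc (by positivity) hρ
  have hprod : P * ∏ i, (1 + e i) ^ c i = ∏ i, I i ^ c i := by
    rw [hP, ← Finset.prod_mul_distrib]
    refine Finset.prod_congr rfl fun i _ => ?_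
    rw [← Real.mul_rpow (hpos i x).le ((by positivity : 0 ≤ ε / M).trans (hρ i))]
    congr 1
    have := (hpos i x).ne'
    simp only [he]; field_simp; ring
  have hsum2 : (∑ i, c i * e i ^ 2) / (ε / M) ≤
      S * ((K * m₂ / ε) ^ 2 * s ^ 3) / (ε / M) := by
    gcongr
    rw [hS, Finset.sum_mul]
    exact Finset.sum_le_sum fun i _ => mul_le_mul_of_nonneg_left (he2 i) (hc i)
  have hPB : P * (S * ((K * m₂ / ε) ^ 2 * s ^ 3) / (ε / M)) ≤ B * s ^ 3 := by
    calc _ ≤ (∏ i, M ^ c i) * (S * ((K * m₂ / ε) ^ 2 * s ^ 3) / (ε / M)) :=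
          mul_le_mul_of_nonneg_right hPM (by positivity)
      _ = _ := by rw [hB]; ring
  calc _ ≤ _ := hstep
    _ ≤ P * (∏ i, (1 + e i) ^ c i + S * ((K * m₂ / ε) ^ 2 * s ^ 3) / (ε / M)) +
        C₀ * (s ^ 3 * m₃) := by
      refine add_le_add_left (mul_le_mul_of_nonneg_left ?_ hP0) _
      linarith
    _ ≤ _ := by
      rw [mul_add, hprod]
      linarith

end Step

/-! ### Iterating the heat flow -/

section Iteration

variable {E : Type*} [NormedAddCommGroup E] [InnerProductSpace ℝ E] [FiniteDimensional ℝ E]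
  [MeasurableSpace E] [BorelSpace E] {ι : Type*} [Fintype ι]

/-- The Gaussian form of the Brascamp-Lieb inequality for tame functions: the heat flow up to
time `1` is cut into `N` steps of length `1 / N`, whose errors add up to `O(N ^ (-1 / 2))`. -/
theorem IsTame.integral_prod_rpow_le {c : ι → ℝ} (hc : ∀ i, 0 ≤ c i) {W : ι → Submodule ℝ E}
    (hW : ∀ w : ι → E, (∀ i, w i ∈ W i) → ‖∑ i, c i • w i‖ ^ 2 ≤ ∑ i, c i * ‖w i‖ ^ 2)
    {ε M K : ℝ} (hε : 0 < ε) (hM : 0 < M) (hK : 0 ≤ K) {φ : ι → E → ℝ} {p : ι → E → E}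
    (hφ : ∀ i, IsTame (W i) ε M K (φ i) (p i)) :
    ∫ y, ∏ i, φ i y ^ c i ∂(stdGaussian E) ≤ ∏ i, (∫ y, φ i y ∂(stdGaussian E)) ^ c i := by
  obtain ⟨C, hC, hstep⟩ := IsTame.exists_integral_prod_rpow_le_add c hc W hW hε hM hK
  have hiter : ∀ t, 0 ≤ t → t ≤ 1 → ∀ (k : ℕ) (φ : ι → E → ℝ) (p : ι → E → E),
      (∀ i, IsTame (W i) ε M K (φ i) (p i)) → ∀ x,
      ∫ y, ∏ i, φ i (x + y) ^ c i ∂(heatMeasure E (k * t)) ≤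
        ∏ i, (∫ y, φ i (x + y) ∂(heatMeasure E (k * t))) ^ c i + k * (C * √t ^ 3) := by
    intro t ht ht1 k
    induction k with
    | zero => intro φ p hφ x; simp [heatMeasure_zero]
    | succ k ih =>
      intro φ p hφ x
      have hkt : (0 : ℝ) ≤ k * t := by positivity
      have hadd : ((k + 1 : ℕ) : ℝ) * t = k * t + t := by push_cast; ring
      have hφ' := fun i => (hφ i).average hε.le (heatMeasure E t)
      have hcont' := IsTame.continuous_prod_rpow hc hφ'
      rw [hadd, integral_heatMeasure_add hkt ht (f := fun y => ∏ i, φ i (x + y) ^ c i)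
        ((IsTame.continuous_prod_rpow hc hφ).comp (by fun_prop))
        (fun y => IsTame.abs_prod_rpow_le hε.le hc hφ _)]
      have hsplit : ∀ i, ∫ y, φ i (x + y) ∂(heatMeasure E (k * t + t)) =
          ∫ z, ∫ y, φ i (x + z + y) ∂(heatMeasure E t) ∂(heatMeasure E (k * t)) := fun i => by
        rw [integral_heatMeasure_add hkt ht (f := fun y => φ i (x + y))
          ((hφ i).continuous.comp (by fun_prop)) fun y => (hφ i).abs_le hε.le _]
        simp_rw [add_assoc]
      simp_rw [hsplit]
      have hint : Integrable (fun z => ∏ i, (∫ y, φ i (x + z + y) ∂(heatMeasure E t)) ^ c i)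
          (heatMeasure E (k * t)) := by
        have : Continuous fun z => ∏ i, (∫ y, φ i (x + z + y) ∂(heatMeasure E t)) ^ c i :=
          hcont'.comp (by fun_prop)
        exact this.integrable_of_norm_le _ fun z => IsTame.abs_prod_rpow_le hε.le hc hφ' _
      calc ∫ z, ∫ y, ∏ i, φ i (x + (z + y)) ^ c i ∂(heatMeasure E t) ∂(heatMeasure E (k * t))
          ≤ ∫ z, (∏ i, (∫ y, φ i (x + z + y) ∂(heatMeasure E t)) ^ c i + C * √t ^ 3)
              ∂(heatMeasure E (k * t)) := by
            refine integral_mono_of_nonneg (Eventually.of_forall fun z => ?_)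
              (hint.add (integrable_const _)) (Eventually.of_forall fun z => ?_)
            · exact integral_nonneg fun y => Finset.prod_nonneg fun i _ =>
                Real.rpow_nonneg (hε.le.trans ((hφ i).le _)) _
            · simp_rw [← add_assoc]
              exact hstep φ p hφ t ht ht1 (x + z)
        _ = ∫ z, ∏ i, (∫ y, φ i (x + z + y) ∂(heatMeasure E t)) ^ c i ∂(heatMeasure E (k * t)) +
              C * √t ^ 3 := by
            rw [integral_add hint (integrable_const _)]; simp
        _ ≤ _ := by
            have := ih _ _ hφ' x
            push_cast
            linarith
  have hN : ∀ N : ℕ, ∫ y, ∏ i, φ i y ^ c i ∂(stdGaussian E) ≤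
      ∏ i, (∫ y, φ i y ∂(stdGaussian E)) ^ c i + C * √(1 / ((N : ℝ) + 1)) := by
    intro N
    have hpos : (0 : ℝ) < N + 1 := by positivity
    have h := hiter (1 / ((N : ℝ) + 1)) (by positivity)
      ((div_le_one hpos).2 (by linarith [(Nat.cast_nonneg N : (0 : ℝ) ≤ N)])) (N + 1) φ p hφ 0
    have h1 : ((N + 1 : ℕ) : ℝ) * (1 / ((N : ℝ) + 1)) = 1 := by push_cast; field_simp
    have h2 : ((N + 1 : ℕ) : ℝ) * (C * √(1 / ((N : ℝ) + 1)) ^ 3) = C * √(1 / ((N : ℝ) + 1)) := by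
      rw [pow_succ, Real.sq_sqrt (by positivity)]
      calc _ = (((N + 1 : ℕ) : ℝ) * (1 / ((N : ℝ) + 1))) * (C * √(1 / ((N : ℝ) + 1))) := by ring
        _ = _ := by rw [h1, one_mul]
    rw [h1, h2, heatMeasure_one] at h
    simpa only [zero_add] using h
  have hlim : Tendsto (fun N : ℕ => ∏ i, (∫ y, φ i y ∂(stdGaussian E)) ^ c i +
      C * √(1 / ((N : ℝ) + 1))) atTop (𝓝 (∏ i, (∫ y, φ i y ∂(stdGaussian E)) ^ c i)) := by
    have h1 := ((Real.continuous_sqrt.tendsto 0).comp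
      (tendsto_one_div_add_atTop_nhds_zero_nat (𝕜 := ℝ))).const_mul C
    simpa using h1.const_add (∏ i, (∫ y, φ i y ∂(stdGaussian E)) ^ c i)
  exact ge_of_tendsto hlim (Eventually.of_forall hN)

end Iteration

section Smooth

variable {E : Type*} [NormedAddCommGroup E] [InnerProductSpace ℝ E] [FiniteDimensional ℝ E]
  {F : Type*} [NormedAddCommGroup F] [InnerProductSpace ℝ F] [FiniteDimensional ℝ F]

omit [FiniteDimensional ℝ E] in
lemma IsTame.mono {W : Submodule ℝ E} {ε M K M' K' : ℝ} {φ : E → ℝ} {p : E → E}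
    (h : IsTame W ε M K φ p) (hM : M ≤ M') (hK : K ≤ K') : IsTame W ε M' K' φ p where
  continuous := h.continuous
  continuous_grad := h.continuous_grad
  le := h.le
  le' x := (h.le' x).trans hM
  lipschitz x k := (h.lipschitz x k).trans (by gcongr)
  norm_grad_le x := (h.norm_grad_le x).trans hK
  grad_mem := h.grad_mem
  taylor x k := (h.taylor x k).trans (by gcongr)

/-- A nonnegative smooth compactly supported function of `Q x`, shifted by `ε`, is tame. -/
lemma exists_isTame_comp (Q : E →L[ℝ] F) {ψ : F → ℝ} (hψ : ContDiff ℝ 2 ψ)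
    (hs : HasCompactSupport ψ) (h0 : ∀ y, 0 ≤ ψ y) (ε : ℝ) :
    ∃ M K, ∃ p : E → E, IsTame (LinearMap.range (Q.adjoint : F →ₗ[ℝ] E)) ε M K
      (fun x => ψ (Q x) + ε) p := by
  obtain ⟨B, hB⟩ := hs.exists_bound_of_continuous hψ.continuous
  have hd : ContDiff ℝ 1 (fderiv ℝ ψ) := hψ.fderiv_right (by norm_num)
  obtain ⟨L, hL⟩ := (hs.fderiv ℝ).exists_bound_of_continuous hd.continuous
  obtain ⟨L₂, hL₂⟩ := hd.lipschitzWith_of_hasCompactSupport (hs.fderiv ℝ) (by norm_num)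
  have hL0 : 0 ≤ L := (norm_nonneg _).trans (hL 0)
  have hdiff : Differentiable ℝ ψ := hψ.differentiable (by norm_num)
  have hin : ∀ x h, ⟪Q.adjoint ((InnerProductSpace.toDual ℝ F).symm (fderiv ℝ ψ (Q x))), h⟫ =
      fderiv ℝ ψ (Q x) (Q h) := fun x h => by
    rw [ContinuousLinearMap.adjoint_inner_left, InnerProductSpace.toDual_symm_apply]
  refine ⟨B + ε, L * ‖Q‖ + L₂ * ‖Q‖ ^ 2,
    fun x => Q.adjoint ((InnerProductSpace.toDual ℝ F).symm (fderiv ℝ ψ (Q x))),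
    ?_, ?_, ?_, ?_, ?_, ?_, ?_, ?_⟩
  · exact (hψ.continuous.comp Q.continuous).add continuous_const
  · exact Q.adjoint.continuous.comp ((InnerProductSpace.toDual ℝ F).symm.continuous.comp
      (hd.continuous.comp Q.continuous))
  · intro x; linarith [h0 (Q x)]
  · intro x
    linarith [le_abs_self (ψ (Q x)), hB (Q x), Real.norm_eq_abs (ψ (Q x))]
  · intro x h
    have h1 := Convex.norm_image_sub_le_of_norm_fderiv_le (𝕜 := ℝ) (f := ψ) (C := L)
      (s := Set.univ) (fun y _ => hdiff y) (fun y _ => hL y) convex_univ (Set.mem_univ (Q x))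
      (Set.mem_univ (Q (x + h)))
    rw [← map_sub, add_sub_cancel_left, Real.norm_eq_abs] at h1
    rw [add_sub_add_right_eq_sub]
    refine h1.trans ?_
    have h2 := mul_le_mul_of_nonneg_left (Q.le_opNorm h) hL0
    have h3 : 0 ≤ (L₂ : ℝ) * ‖Q‖ ^ 2 * ‖h‖ := by positivity
    linarith
  · intro x
    have h1 : ‖Q.adjoint ((InnerProductSpace.toDual ℝ F).symm (fderiv ℝ ψ (Q x)))‖ ≤ ‖Q‖ * L := by
      refine (Q.adjoint.le_opNorm _).trans ?_
      rw [LinearIsometryEquiv.norm_map, LinearIsometryEquiv.norm_map]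
      exact mul_le_mul_of_nonneg_left (hL _) (norm_nonneg _)
    have h3 : 0 ≤ (L₂ : ℝ) * ‖Q‖ ^ 2 := by positivity
    linarith
  · intro x
    exact ⟨_, rfl⟩
  · intro x h
    have hball : ∀ y ∈ Metric.closedBall (Q x) ‖Q h‖,
        ‖fderiv ℝ ψ y - fderiv ℝ ψ (Q x)‖ ≤ L₂ * ‖Q h‖ := fun y hy => by
      rw [← dist_eq_norm]
      exact (hL₂.dist_le_mul _ _).trans
        (mul_le_mul_of_nonneg_left (Metric.mem_closedBall.1 hy) L₂.2)
    have h1 := Convex.norm_image_sub_le_of_norm_fderiv_le' (𝕜 := ℝ) (f := ψ)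
      (fun y _ => hdiff y) hball (convex_closedBall _ _)
      (Metric.mem_closedBall_self (norm_nonneg _)) (y := Q (x + h)) (by simp)
    rw [← map_sub, add_sub_cancel_left, Real.norm_eq_abs] at h1
    rw [hin, add_sub_add_right_eq_sub]
    refine h1.trans ?_
    have h2 : ‖Q h‖ * ‖Q h‖ ≤ (‖Q‖ * ‖h‖) * (‖Q‖ * ‖h‖) :=
      mul_le_mul (Q.le_opNorm h) (Q.le_opNorm h) (norm_nonneg _) (by positivity)
    have h3 := mul_le_mul_of_nonneg_left h2 L₂.2
    have h4 : 0 ≤ L * ‖Q‖ * ‖h‖ ^ 2 := by positivity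
    calc (L₂ : ℝ) * ‖Q h‖ * ‖Q h‖ = L₂ * (‖Q h‖ * ‖Q h‖) := mul_assoc _ _ _
      _ ≤ L₂ * ((‖Q‖ * ‖h‖) * (‖Q‖ * ‖h‖)) := h3
      _ ≤ _ := by linarith

end Smooth

/-! ### The geometric inequality for Gaussian measures -/

section Density

/-- A form of Fatou's lemma: an almost everywhere limit of nonnegative functions inherits
integrability and upper bounds on the integrals. -/
lemma integrable_and_integral_le_of_tendsto_ae {X : Type*} [MeasurableSpace X] {μ : Measure X}
    {G : ℕ → X → ℝ} {g : X → ℝ} {b : ℕ → ℝ} {B : ℝ} (hG : ∀ k, Integrable (G k) μ)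
    (hG0 : ∀ k x, 0 ≤ G k x) (hb : ∀ k, ∫ x, G k x ∂μ ≤ b k) (hbB : Tendsto b atTop (𝓝 B))
    (hlim : ∀ᵐ x ∂μ, Tendsto (fun k => G k x) atTop (𝓝 (g x))) :
    Integrable g μ ∧ ∫ x, g x ∂μ ≤ B := by
  have hB : 0 ≤ B := ge_of_tendsto hbB (Eventually.of_forall fun k =>
    (integral_nonneg (hG0 k)).trans (hb k))
  have hg0 : ∀ᵐ x ∂μ, 0 ≤ g x := hlim.mono fun x hx =>
    ge_of_tendsto hx (Eventually.of_forall fun k => hG0 k x)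
  have hgm : AEStronglyMeasurable g μ :=
    aestronglyMeasurable_of_tendsto_ae atTop (fun k => (hG k).aestronglyMeasurable) hlim
  have hle : ∫⁻ x, ENNReal.ofReal (g x) ∂μ ≤ ENNReal.ofReal B := by
    calc ∫⁻ x, ENNReal.ofReal (g x) ∂μ
        = ∫⁻ x, liminf (fun k => ENNReal.ofReal (G k x)) atTop ∂μ :=
          lintegral_congr_ae (hlim.mono fun x hx => ((ENNReal.tendsto_ofReal hx).liminf_eq).symm)
      _ ≤ liminf (fun k => ∫⁻ x, ENNReal.ofReal (G k x) ∂μ) atTop :=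
          lintegral_liminf_le' fun k => (hG k).aestronglyMeasurable.aemeasurable.ennreal_ofReal
      _ ≤ liminf (fun k => ENNReal.ofReal (b k)) atTop := by
          refine liminf_le_liminf (Eventually.of_forall fun k => ?_)
          rw [← ofReal_integral_eq_lintegral_ofReal (hG k) (Eventually.of_forall (hG0 k))]
          exact ENNReal.ofReal_le_ofReal (hb k)
      _ = ENNReal.ofReal B := (ENNReal.tendsto_ofReal hbB).liminf_eq
  have hgi : Integrable g μ := by
    refine ⟨hgm, ?_⟩
    rw [hasFiniteIntegral_iff_ofReal hg0]
    exact hle.trans_lt ENNReal.ofReal_lt_top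
  refine ⟨hgi, ?_⟩
  rw [integral_eq_lintegral_of_nonneg_ae hg0 hgm]
  exact ENNReal.toReal_le_of_le_ofReal hB hle

/-- Nonnegative integrable functions are approximated in `L¹` by nonnegative smooth compactly
supported functions, shifted by a positive constant. -/
lemma exists_contDiff_nonneg_integral_sub_le {F : Type*} [NormedAddCommGroup F] [NormedSpace ℝ F]
    [FiniteDimensional ℝ F] [MeasurableSpace F] [BorelSpace F] {μ : Measure F}
    [IsProbabilityMeasure μ] {f : F → ℝ} (hf0 : ∀ y, 0 ≤ f y) (hf : Integrable f μ) {ε : ℝ}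
    (hε : 0 < ε) :
    ∃ ψ : F → ℝ, ContDiff ℝ 2 ψ ∧ HasCompactSupport ψ ∧ (∀ y, 0 ≤ ψ y) ∧
      ∫ y, |ψ y + ε - f y| ∂μ ≤ 2 * ε := by
  obtain ⟨g, hgs, hgd, hgf⟩ := (memLp_one_iff_integrable.2 hf).exist_eLpNorm_sub_le
    (by simp) le_rfl hε
  -- a smooth, nonnegative substitute for `|g|`, within `ε` of it after the shift
  set σ : ℝ → ℝ := fun t => √(t ^ 2 + ε ^ 2) - ε with hσ
  have hpos : ∀ t : ℝ, t ^ 2 + ε ^ 2 ≠ 0 := fun t => by positivity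
  have hσd : ContDiff ℝ 2 σ :=
    (ContDiff.sqrt (by fun_prop) hpos).sub contDiff_const
  have hσ0 : σ 0 = 0 := by simp [hσ, Real.sqrt_sq hε.le]
  have hgi : Integrable g μ := hgd.continuous.integrable_of_hasCompactSupport hgs
  refine ⟨fun y => σ (g y), hσd.comp (by exact_mod_cast contDiff_infty.1 hgd 2),
    hgs.comp_left hσ0, fun y => ?_, ?_⟩
  · have : √(ε ^ 2) ≤ √(g y ^ 2 + ε ^ 2) := Real.sqrt_le_sqrt (by nlinarith [sq_nonneg (g y)])
    rw [Real.sqrt_sq hε.le] at this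
    simp only [hσ]; linarith
  · have hpt : ∀ y, |σ (g y) + ε - f y| ≤ ε + ‖f y - g y‖ := fun y => by
      have h1 : |g y| ≤ √(g y ^ 2 + ε ^ 2) := Real.abs_le_sqrt (by nlinarith [sq_nonneg ε])
      have h2 : √(g y ^ 2 + ε ^ 2) ≤ |g y| + ε := by
        rw [Real.sqrt_le_left (by positivity)]
        nlinarith [sq_abs (g y), abs_nonneg (g y)]
      have h3 : |(|g y| - f y)| ≤ ‖f y - g y‖ := by
        have := abs_abs_sub_abs_le_abs_sub (g y) (f y)
        rwa [abs_of_nonneg (hf0 y), abs_sub_comm (g y)] at this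
      simp only [hσ, sub_add_cancel]
      rw [abs_le] at h3 ⊢
      constructor <;> linarith
    have hfg : ∫ y, ‖f y - g y‖ ∂μ ≤ ε := by
      have h1 := ofReal_integral_norm_eq_lintegral_enorm (hf.sub hgi)
      rw [← eLpNorm_one_eq_lintegral_enorm] at h1
      rw [← h1] at hgf
      exact (ENNReal.ofReal_le_ofReal_iff hε.le).1 hgf
    have hi : Integrable (fun y => ε + ‖f y - g y‖) μ :=
      (integrable_const _).add (hf.sub hgi).norm
    calc ∫ y, |σ (g y) + ε - f y| ∂μ ≤ ∫ y, (ε + ‖f y - g y‖) ∂μ :=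
          integral_mono_of_nonneg (Eventually.of_forall fun y => abs_nonneg _) hi
            (Eventually.of_forall hpt)
      _ = ε + ∫ y, ‖f y - g y‖ ∂μ := by
          have h2 : Integrable (fun y => ‖f y - g y‖) μ := (hf.sub hgi).norm
          rw [integral_add (integrable_const _) h2]; simp
      _ ≤ 2 * ε := by linarith

end Density

section Gaussian

variable {E : Type*} [NormedAddCommGroup E] [InnerProductSpace ℝ E] [FiniteDimensional ℝ E]
  [MeasurableSpace E] [BorelSpace E]

/-- A coisometry maps the standard Gaussian measure to the standard Gaussian measure. -/
lemma map_stdGaussian_of_norm_adjoint {F : Type*} [NormedAddCommGroup F] [InnerProductSpace ℝ F]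
    [FiniteDimensional ℝ F] [MeasurableSpace F] [BorelSpace F] (Q : E →L[ℝ] F)
    (hQ : ∀ u, ‖Q.adjoint u‖ = ‖u‖) : (stdGaussian E).map Q = stdGaussian F := by
  have := Measure.isProbabilityMeasure_map (μ := stdGaussian E) (f := Q) (by fun_prop)
  apply Measure.ext_of_charFun
  ext u
  have h : charFun ((stdGaussian E).map Q) u = charFun (stdGaussian E) (Q.adjoint u) := by
    simp only [charFun_apply]
    rw [integral_map (by fun_prop) (by fun_prop)]
    simp_rw [ContinuousLinearMap.adjoint_inner_right]
  rw [h, charFun_stdGaussian, charFun_stdGaussian, hQ]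

lemma integrable_comp_coisometry {F : Type*} [NormedAddCommGroup F] [InnerProductSpace ℝ F]
    [FiniteDimensional ℝ F] [MeasurableSpace F] [BorelSpace F] {Q : E →L[ℝ] F}
    (hQ : ∀ u, ‖Q.adjoint u‖ = ‖u‖)
    {f : F → ℝ} (hf : Integrable f (stdGaussian (F))) :
    Integrable (fun x => f (Q x)) (stdGaussian E) := by
  rw [← map_stdGaussian_of_norm_adjoint Q hQ] at hf
  exact hf.comp_measurable (by fun_prop)

lemma integral_comp_coisometry {F : Type*} [NormedAddCommGroup F] [InnerProductSpace ℝ F]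
    [FiniteDimensional ℝ F] [MeasurableSpace F] [BorelSpace F] {Q : E →L[ℝ] F}
    (hQ : ∀ u, ‖Q.adjoint u‖ = ‖u‖)
    {f : F → ℝ} (hf : AEStronglyMeasurable f (stdGaussian (F))) :
    ∫ x, f (Q x) ∂(stdGaussian E) = ∫ y, f y ∂(stdGaussian (F)) := by
  rw [← map_stdGaussian_of_norm_adjoint Q hQ] at hf ⊢
  rw [integral_map (by fun_prop) hf]

variable {ι : Type*} [Fintype ι] {F : ι → Type*} [∀ i, NormedAddCommGroup (F i)]
  [∀ i, InnerProductSpace ℝ (F i)] [∀ i, FiniteDimensional ℝ (F i)]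

omit [MeasurableSpace E] [BorelSpace E] in
/-- The convexity inequality behind the heat flow, by Cauchy-Schwarz and duality: with
`v = ∑ i, c i • w i` and `w i = (Q i)^* (u i)`, one has
`‖v‖ ^ 2 = ∑ i, c i * ⟪u i, Q i v⟫ ≤ (∑ i, c i * ‖u i‖ ^ 2 + ∑ i, c i * ‖Q i v‖ ^ 2) / 2`. -/
lemma norm_sum_smul_sq_le_of_mem_range_adjoint {c : ι → ℝ} (hc : ∀ i, 0 ≤ c i)
    (Q : ∀ i, E →L[ℝ] F i) (hQ : ∀ i u, ‖(Q i).adjoint u‖ = ‖u‖)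
    (hI : ∀ x, ∑ i, c i * ‖Q i x‖ ^ 2 = ‖x‖ ^ 2) (w : ι → E)
    (hw : ∀ i, w i ∈ LinearMap.range ((Q i).adjoint : F i →ₗ[ℝ] E)) :
    ‖∑ i, c i • w i‖ ^ 2 ≤ ∑ i, c i * ‖w i‖ ^ 2 := by
  choose u hu using hw
  set v := ∑ i, c i • w i with hv
  have h1 : ‖v‖ ^ 2 = ∑ i, c i * ⟪u i, Q i v⟫ := by
    rw [← real_inner_self_eq_norm_sq]
    nth_rw 1 [hv]
    rw [sum_inner]
    refine Finset.sum_congr rfl fun i _ => ?_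
    rw [real_inner_smul_left, ← hu i, ← ContinuousLinearMap.adjoint_inner_left]
    rfl
  have h2 : ∑ i, c i * ⟪u i, Q i v⟫ ≤ ∑ i, c i * ((‖w i‖ ^ 2 + ‖Q i v‖ ^ 2) / 2) := by
    refine Finset.sum_le_sum fun i _ => mul_le_mul_of_nonneg_left ?_ (hc i)
    have h3 : ‖w i‖ = ‖u i‖ := by rw [← hu i]; exact hQ i (u i)
    rw [h3]
    nlinarith [real_inner_le_norm (u i) (Q i v), sq_nonneg (‖u i‖ - ‖Q i v‖)]
  have h4 : ∑ i, c i * ((‖w i‖ ^ 2 + ‖Q i v‖ ^ 2) / 2) =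
      (∑ i, c i * ‖w i‖ ^ 2 + ∑ i, c i * ‖Q i v‖ ^ 2) / 2 := by
    rw [← Finset.sum_add_distrib, Finset.sum_div]
    exact Finset.sum_congr rfl fun i _ => by ring
  rw [h4, hI] at h2
  linarith

variable [∀ i, MeasurableSpace (F i)] [∀ i, BorelSpace (F i)]

/-- The geometric Brascamp-Lieb inequality with respect to Gaussian measures. -/
theorem integral_stdGaussian_prod_rpow_le {c : ι → ℝ} (hc : ∀ i, 0 ≤ c i)
    (Q : ∀ i, E →L[ℝ] F i) (hQ : ∀ i u, ‖(Q i).adjoint u‖ = ‖u‖)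
    (hI : ∀ x, ∑ i, c i * ‖Q i x‖ ^ 2 = ‖x‖ ^ 2) {f : ∀ i, F i → ℝ}
    (hf0 : ∀ i y, 0 ≤ f i y) (hf : ∀ i, Integrable (f i) (stdGaussian (F i))) :
    Integrable (fun x => ∏ i, f i (Q i x) ^ c i) (stdGaussian E) ∧
      ∫ x, ∏ i, f i (Q i x) ^ c i ∂(stdGaussian E) ≤
        ∏ i, (∫ y, f i y ∂(stdGaussian (F i))) ^ c i := by
  set δ : ℕ → ℝ := fun k => 1 / ((k : ℝ) + 1) with hδ
  have hδ0 : ∀ k, 0 < δ k := fun k => by simp only [hδ]; positivity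
  have hδlim : Tendsto δ atTop (𝓝 0) := tendsto_one_div_add_atTop_nhds_zero_nat
  choose ψ hψd hψs hψ0 hψf using fun (k : ℕ) (i : ι) =>
    exists_contDiff_nonneg_integral_sub_le (hf0 i) (hf i) (hδ0 k)
  have hψi : ∀ k i, Integrable (fun y => ψ k i y + δ k) (stdGaussian (F i)) := fun k i =>
    ((hψd k i).continuous.integrable_of_hasCompactSupport (hψs k i)).add (integrable_const _)
  have hpos : ∀ k i y, 0 < ψ k i y + δ k := fun k i y => by linarith [hψ0 k i y, hδ0 k]
  -- the inequality for the approximations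
  have hk : ∀ k, Integrable (fun x => ∏ i, (ψ k i (Q i x) + δ k) ^ c i) (stdGaussian E) ∧
      ∫ x, ∏ i, (ψ k i (Q i x) + δ k) ^ c i ∂(stdGaussian E) ≤
        ∏ i, (∫ y, (ψ k i y + δ k) ∂(stdGaussian (F i))) ^ c i := by
    intro k
    choose M K p hp using fun i => exists_isTame_comp (Q i) (hψd k i) (hψs k i) (hψ0 k i) (δ k)
    obtain ⟨M', hM'⟩ := (Set.finite_range M).bddAbove
    obtain ⟨K', hK'⟩ := (Set.finite_range K).bddAbove
    have hp' := fun i => (hp i).mono (M' := max M' 1) (K' := max K' 1)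
      ((hM' ⟨i, rfl⟩).trans (le_max_left _ _)) ((hK' ⟨i, rfl⟩).trans (le_max_left _ _))
    refine ⟨(IsTame.continuous_prod_rpow hc hp').integrable_of_norm_le _
      fun y => IsTame.abs_prod_rpow_le (hδ0 k).le hc hp' y, ?_⟩
    have := IsTame.integral_prod_rpow_le hc
      (norm_sum_smul_sq_le_of_mem_range_adjoint hc Q hQ hI) (hδ0 k) (by positivity)
      (by positivity) hp'
    refine this.trans_eq (Finset.prod_congr rfl fun i _ => ?_)
    rw [integral_comp_coisometry (f := fun y => ψ k i y + δ k) (hQ i)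
      (hψi k i).aestronglyMeasurable]
  have hdi : ∀ k i, Integrable (fun y => |ψ k i y + δ k - f i y|) (stdGaussian (F i)) :=
    fun k i => ((hψi k i).sub (hf i)).abs
  have hδ2 : Tendsto (fun k => 2 * δ k) atTop (𝓝 0) := by simpa using hδlim.const_mul 2
  have hlim : ∀ i, Tendsto (fun k => ∫ y, (ψ k i y + δ k) ∂(stdGaussian (F i))) atTop
      (𝓝 (∫ y, f i y ∂(stdGaussian (F i)))) := fun i => by
    rw [tendsto_iff_dist_tendsto_zero]
    refine squeeze_zero (fun k => dist_nonneg) (fun k => ?_) hδ2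
    rw [dist_eq_norm, ← integral_sub (hψi k i) (hf i)]
    exact (norm_integral_le_integral_norm _).trans (hψf k i)
  have hB : Tendsto (fun k => ∏ i, (∫ y, (ψ k i y + δ k) ∂(stdGaussian (F i))) ^ c i) atTop
      (𝓝 (∏ i, (∫ y, f i y ∂(stdGaussian (F i))) ^ c i)) :=
    tendsto_finsetProd _ fun i _ => (hlim i).rpow_const (Or.inr (hc i))
  -- a subsequence of the approximations converges almost everywhere
  set H : ℕ → E → ℝ := fun k x => ∑ i, |ψ k i (Q i x) + δ k - f i (Q i x)| with hH
  have hHi : ∀ k i, Integrable (fun x => |ψ k i (Q i x) + δ k - f i (Q i x)|) (stdGaussian E) :=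
    fun k i => integrable_comp_coisometry (f := fun y => |ψ k i y + δ k - f i y|) (hQ i) (hdi k i)
  have hH0 : ∀ k x, 0 ≤ H k x := fun k x => Finset.sum_nonneg fun i _ => abs_nonneg _
  have hHint : ∀ k, Integrable (H k) (stdGaussian E) := fun k =>
    integrable_finsetSum _ fun i _ => hHi k i
  have hHle : ∀ k, ∫ x, H k x ∂(stdGaussian E) ≤ Fintype.card ι * (2 * δ k) := fun k => by
    rw [integral_finsetSum _ fun i _ => hHi k i]
    calc _ ≤ ∑ _i : ι, 2 * δ k := Finset.sum_le_sum fun i _ => by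
          rw [integral_comp_coisometry (f := fun y => |ψ k i y + δ k - f i y|) (hQ i)
            (hdi k i).aestronglyMeasurable]
          exact hψf k i
      _ = _ := by simp
  have hHmeas : TendstoInMeasure (stdGaussian E) H atTop 0 := by
    refine tendstoInMeasure_of_tendsto_eLpNorm one_ne_zero
      (fun k => (hHint k).aestronglyMeasurable) aestronglyMeasurable_zero ?_
    have h1 : Tendsto (fun k => ENNReal.ofReal (Fintype.card ι * (2 * δ k))) atTop (𝓝 0) := by
      simpa using ENNReal.tendsto_ofReal (hδ2.const_mul (Fintype.card ι : ℝ))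
    refine tendsto_of_tendsto_of_tendsto_of_le_of_le tendsto_const_nhds h1
      (fun _ => zero_le) fun k => ?_
    simp only [sub_zero]
    rw [eLpNorm_one_eq_lintegral_enorm, ← ofReal_integral_norm_eq_lintegral_enorm (hHint k)]
    refine ENNReal.ofReal_le_ofReal ?_
    simp_rw [Real.norm_eq_abs, abs_of_nonneg (hH0 k _)]
    exact hHle k
  obtain ⟨ns, hns, hae⟩ := hHmeas.exists_seq_tendsto_ae
  refine integrable_and_integral_le_of_tendsto_ae (fun k => (hk (ns k)).1)
    (fun k x => Finset.prod_nonneg fun i _ => Real.rpow_nonneg (hpos _ _ _).le _)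
    (fun k => (hk (ns k)).2) (hB.comp hns.tendsto_atTop) (hae.mono fun x hx => ?_)
  refine tendsto_finsetProd _ fun i _ => Tendsto.rpow_const ?_ (Or.inr (hc i))
  rw [tendsto_iff_dist_tendsto_zero]
  refine squeeze_zero (fun k => dist_nonneg) (fun k => ?_) hx
  rw [Real.dist_eq]
  exact Finset.single_le_sum (f := fun i => |ψ (ns k) i (Q i x) + δ (ns k) - f i (Q i x)|)
    (fun i _ => abs_nonneg _) (Finset.mem_univ i)

end Gaussian

/-! ### The geometric inequality for Lebesgue measure -/

section Lebesgue

variable {E : Type*} [NormedAddCommGroup E] [InnerProductSpace ℝ E] [FiniteDimensional ℝ E]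
  [MeasurableSpace E] [BorelSpace E]

variable (E) in
/-- The total mass `(2 * π) ^ (dim E / 2)` of the function `x ↦ exp (-‖x‖ ^ 2 / 2)` on `E`. -/
noncomputable def gaussianMass : ℝ := (2 * Real.pi) ^ (Module.finrank ℝ E / 2 : ℝ)

omit [FiniteDimensional ℝ E] [MeasurableSpace E] [BorelSpace E] in
lemma gaussianMass_pos : 0 < gaussianMass E := Real.rpow_pos_of_pos (by positivity) _

lemma integral_exp_neg_norm_sq_div_two :
    ∫ x : E, Real.exp (-‖x‖ ^ 2 / 2) = gaussianMass E := by
  have h := GaussianFourier.integral_rexp_neg_mul_sq_norm (V := E) (b := 1 / 2) (by norm_num)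
  rw [gaussianMass, show (2 : ℝ) * Real.pi = Real.pi / (1 / 2) by ring, ← h]
  congr with x
  congr 1
  ring

lemma integrable_exp_neg_norm_sq_div_two :
    Integrable fun x : E => Real.exp (-‖x‖ ^ 2 / 2) := by
  -- a function with nonzero Bochner integral is integrable
  by_contra h
  have h1 := integral_exp_neg_norm_sq_div_two (E := E)
  rw [integral_undef h] at h1
  exact gaussianMass_pos.ne h1

/-- The density of the standard Gaussian measure. -/
lemma stdGaussian_eq_withDensity : stdGaussian E = volume.withDensity
    fun x => ENNReal.ofReal ((gaussianMass E)⁻¹ * Real.exp (-‖x‖ ^ 2 / 2)) := by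
  have hm : Measurable fun x : E =>
    ENNReal.ofReal ((gaussianMass E)⁻¹ * Real.exp (-‖x‖ ^ 2 / 2)) := by fun_prop
  have h0 : ∀ x : E, 0 ≤ (gaussianMass E)⁻¹ * Real.exp (-‖x‖ ^ 2 / 2) := fun x =>
    mul_nonneg (inv_nonneg.2 gaussianMass_pos.le) (Real.exp_nonneg _)
  have : IsFiniteMeasure (volume.withDensity fun x : E =>
      ENNReal.ofReal ((gaussianMass E)⁻¹ * Real.exp (-‖x‖ ^ 2 / 2))) :=
    isFiniteMeasure_withDensity_ofReal
      (integrable_exp_neg_norm_sq_div_two.const_mul _).hasFiniteIntegral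
  apply Measure.ext_of_charFun
  ext t
  rw [charFun_stdGaussian, charFun_apply, integral_withDensity_eq_integral_toReal_smul hm
    (Eventually.of_forall fun x => ENNReal.ofReal_lt_top)]
  have h := GaussianFourier.integral_cexp_neg_mul_sq_norm_add (V := E) (b := 1 / 2) (by norm_num)
    Complex.I t
  have hmass : ((Real.pi : ℂ) / (1 / 2)) ^ (Module.finrank ℝ E / 2 : ℂ) = (gaussianMass E : ℂ) := by
    rw [gaussianMass, Complex.ofReal_cpow (by positivity)]
    push_cast
    congr 1
    ring
  rw [hmass] at h
  have hpt : ∀ x : E, (ENNReal.ofReal ((gaussianMass E)⁻¹ * Real.exp (-‖x‖ ^ 2 / 2))).toReal •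
      Complex.exp (⟪x, t⟫ * Complex.I) = (gaussianMass E : ℂ)⁻¹ *
        Complex.exp (-(1 / 2) * ‖x‖ ^ 2 + Complex.I * ⟪t, x⟫) := fun x => by
    rw [ENNReal.toReal_ofReal (h0 x), Complex.real_smul]
    push_cast
    rw [mul_assoc, ← Complex.exp_add, real_inner_comm x t]
    congr 2
    ring
  simp_rw [hpt, integral_const_mul]
  rw [h, ← mul_assoc, inv_mul_cancel₀ (by exact_mod_cast gaussianMass_pos.ne'), one_mul,
    Complex.I_sq]
  congr 1
  ring

omit [FiniteDimensional ℝ E] [MeasurableSpace E] [BorelSpace E] in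
lemma toReal_gaussianDensity_smul (f : E → ℝ) (x : E) :
    (ENNReal.ofReal ((gaussianMass E)⁻¹ * Real.exp (-‖x‖ ^ 2 / 2))).toReal •
      (Real.exp (‖x‖ ^ 2 / 2) * f x) = (gaussianMass E)⁻¹ * f x := by
  rw [ENNReal.toReal_ofReal (mul_nonneg (inv_nonneg.2 gaussianMass_pos.le) (Real.exp_nonneg _)),
      smul_eq_mul, mul_assoc, ← mul_assoc (Real.exp _) (Real.exp _), ← Real.exp_add]
  ring_nf
  simp

lemma integrable_stdGaussian_iff {f : E → ℝ} :
    Integrable (fun x => Real.exp (‖x‖ ^ 2 / 2) * f x) (stdGaussian E) ↔ Integrable f := by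
  have hm : Measurable fun x : E =>
    ENNReal.ofReal ((gaussianMass E)⁻¹ * Real.exp (-‖x‖ ^ 2 / 2)) := by fun_prop
  rw [stdGaussian_eq_withDensity, integrable_withDensity_iff_integrable_smul' hm
    (Eventually.of_forall fun x => ENNReal.ofReal_lt_top)]
  simp_rw [toReal_gaussianDensity_smul]
  exact integrable_const_mul_iff (inv_ne_zero gaussianMass_pos.ne').isUnit _

lemma integral_stdGaussian_exp_mul (f : E → ℝ) :
    ∫ x, Real.exp (‖x‖ ^ 2 / 2) * f x ∂(stdGaussian E) = (gaussianMass E)⁻¹ * ∫ x, f x := by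
  have hm : Measurable fun x : E =>
    ENNReal.ofReal ((gaussianMass E)⁻¹ * Real.exp (-‖x‖ ^ 2 / 2)) := by fun_prop
  rw [stdGaussian_eq_withDensity, integral_withDensity_eq_integral_toReal_smul hm
    (Eventually.of_forall fun x => ENNReal.ofReal_lt_top)]
  simp_rw [toReal_gaussianDensity_smul, integral_const_mul]

/-- Change of variables by an invertible linear map. -/
lemma integrable_comp_linearMap_iff_and_integral_eq {T : E →ₗ[ℝ] E}
    (hT : 0 < LinearMap.det T) {f : E → ℝ} :
    (Integrable (fun x => f (T x)) ↔ Integrable f) ∧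
      ∫ x, f x = LinearMap.det T * ∫ x, f (T x) := by
  have hme : MeasurableEmbedding T :=
    (T.equivOfDetNeZero hT.ne').toContinuousLinearEquiv.toHomeomorph.measurableEmbedding
  have hmap := Measure.map_linearMap_addHaar_eq_smul_addHaar (volume : Measure E) hT.ne'
  have hd : 0 < (LinearMap.det T)⁻¹ := inv_pos.2 hT
  rw [abs_of_pos hd] at hmap
  constructor
  · have h := hme.integrable_map_iff (μ := volume) (g := f)
    rw [hmap, integrable_smul_measure (by simpa using hT) ENNReal.ofReal_ne_top] at h
    exact h.symm
  · have h := hme.integral_map (μ := volume) f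
    rw [hmap, integral_smul_measure, ENNReal.toReal_ofReal hd.le, smul_eq_mul] at h
    rw [← h, ← mul_assoc, mul_inv_cancel₀ hT.ne', one_mul]

variable {ι : Type*} [Fintype ι] {F : ι → Type*} [∀ i, NormedAddCommGroup (F i)]
  [∀ i, InnerProductSpace ℝ (F i)] [∀ i, FiniteDimensional ℝ (F i)]

omit [FiniteDimensional ℝ E] [MeasurableSpace E] [BorelSpace E]
  [∀ i, FiniteDimensional ℝ (F i)] in
lemma prod_gaussianMass_rpow {c : ι → ℝ}
    (hdim : ∑ i, c i * (Module.finrank ℝ (F i) : ℝ) = Module.finrank ℝ E) :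
    ∏ i, gaussianMass (F i) ^ c i = gaussianMass E := by
  simp only [gaussianMass]
  simp_rw [← Real.rpow_mul (show (0 : ℝ) ≤ 2 * Real.pi by positivity)]
  rw [← Real.rpow_sum_of_pos (by positivity), ← hdim, Finset.sum_div]
  congr 1
  exact Finset.sum_congr rfl fun i _ => by ring

variable [∀ i, MeasurableSpace (F i)] [∀ i, BorelSpace (F i)]

/-- The geometric Brascamp-Lieb inequality. Dividing all functions by Gaussian densities turns it
into its Gaussian form, as `∑ i, c i * ‖Q i x‖ ^ 2 = ‖x‖ ^ 2`. -/
theorem integral_prod_rpow_le_of_geometric {c : ι → ℝ} (hc : ∀ i, 0 ≤ c i)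
    (Q : ∀ i, E →L[ℝ] F i) (hQ : ∀ i u, ‖(Q i).adjoint u‖ = ‖u‖)
    (hI : ∀ x, ∑ i, c i * ‖Q i x‖ ^ 2 = ‖x‖ ^ 2)
    (hdim : ∑ i, c i * (Module.finrank ℝ (F i) : ℝ) = Module.finrank ℝ E) {f : ∀ i, F i → ℝ}
    (hf0 : ∀ i y, 0 ≤ f i y) (hf : ∀ i, Integrable (f i)) :
    Integrable (fun x => ∏ i, f i (Q i x) ^ c i) ∧
      ∫ x, ∏ i, f i (Q i x) ^ c i ≤ ∏ i, (∫ y, f i y) ^ c i := by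
  have h := integral_stdGaussian_prod_rpow_le hc Q hQ hI
    (f := fun i y => Real.exp (‖y‖ ^ 2 / 2) * f i y)
    (fun i y => mul_nonneg (Real.exp_nonneg _) (hf0 i y))
    (fun i => integrable_stdGaussian_iff.2 (hf i))
  have hprod : ∀ x, ∏ i, (Real.exp (‖Q i x‖ ^ 2 / 2) * f i (Q i x)) ^ c i =
      Real.exp (‖x‖ ^ 2 / 2) * ∏ i, f i (Q i x) ^ c i := fun x => by
    rw [← hI, Finset.sum_div, Real.exp_sum, ← Finset.prod_mul_distrib]
    refine Finset.prod_congr rfl fun i _ => ?_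
    rw [Real.mul_rpow (Real.exp_nonneg _) (hf0 i _), ← Real.exp_mul]
    ring_nf
  simp_rw [hprod, integrable_stdGaussian_iff, integral_stdGaussian_exp_mul] at h
  refine ⟨h.1, ?_⟩
  have hrhs : ∏ i, ((gaussianMass (F i))⁻¹ * ∫ y, f i y) ^ c i =
      (gaussianMass E)⁻¹ * ∏ i, (∫ y, f i y) ^ c i := by
    rw [← prod_gaussianMass_rpow hdim, ← Finset.prod_inv_distrib, ← Finset.prod_mul_distrib]
    refine Finset.prod_congr rfl fun i _ => ?_
    rw [Real.mul_rpow (inv_nonneg.2 gaussianMass_pos.le) (integral_nonneg (hf0 i)),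
      Real.inv_rpow gaussianMass_pos.le]
  rw [hrhs] at h
  exact le_of_mul_le_mul_left h.2 (inv_pos.2 gaussianMass_pos)

end Lebesgue

/-! ### Reduction to geometric data -/

section Matrices

open Matrix

/-- A positive definite matrix has a symmetric square root of positive determinant. -/
lemma Matrix.PosDef.exists_symmetric_sqrt {k : ℕ} {A : Matrix (Fin k) (Fin k) ℝ} (hA : A.PosDef) :
    ∃ R : Matrix (Fin k) (Fin k) ℝ, Rᵀ = R ∧ R * R = A ∧ 0 < R.det := by
  open scoped MatrixOrder in
  have hRR : CFC.sqrt A * CFC.sqrt A = A := CFC.sqrt_mul_sqrt_self A hA.posSemidef.nonneg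
  open scoped MatrixOrder in
  have hR : (CFC.sqrt A).PosSemidef := (CFC.sqrt_nonneg A).posSemidef
  refine ⟨CFC.sqrt A, ?_, hRR, hR.det_nonneg.lt_of_ne fun h0 => ?_⟩
  · simpa [Matrix.IsHermitian] using hR.isHermitian
  · have h1 := hA.det_pos
    rw [← hRR, det_mul, ← h0] at h1
    simp at h1

lemma inner_toEuclideanLin_left {k l : ℕ} (N : Matrix (Fin k) (Fin l) ℝ)
    (x : EuclideanSpace ℝ (Fin l)) (y : EuclideanSpace ℝ (Fin k)) :
    ⟪toEuclideanLin N x, y⟫ = ⟪x, toEuclideanLin Nᵀ y⟫ := by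
  rw [← conjTranspose_eq_transpose_of_trivial, toEuclideanLin_conjTranspose_eq_adjoint,
    LinearMap.adjoint_inner_right]

lemma toEuclideanLin_mul_apply {k l o : ℕ} (N : Matrix (Fin k) (Fin l) ℝ)
    (P : Matrix (Fin l) (Fin o) ℝ) (x : EuclideanSpace ℝ (Fin o)) :
    toEuclideanLin (N * P) x = toEuclideanLin N (toEuclideanLin P x) := by
  rw [toEuclideanLin, toLpLin_mul (q := 2)]
  rfl

lemma toEuclideanLin_one_apply {k : ℕ} (x : EuclideanSpace ℝ (Fin k)) :
    toEuclideanLin (1 : Matrix (Fin k) (Fin k) ℝ) x = x := by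
  simp

end Matrices

namespace BLDatum

open Matrix

variable {n m : ℕ} (D : BLDatum n m)

lemma toEuclideanLin_mat (i : Fin m) : toEuclideanLin (D.mat i) = D.B i :=
  toEuclideanLin.apply_symm_apply _

/-- `B i A (B i)^*` is positive definite because `B i` is surjective. -/
lemma posDef_push {A : Matrix (Fin n) (Fin n) ℝ} (hA : A.PosDef) (i : Fin m) :
    (D.push A i).PosDef := by
  have h := hA.mul_mul_conjTranspose_same (B := D.mat i) ?_
  · rwa [conjTranspose_eq_transpose_of_trivial] at h
  · intro u v huv
    have hsurj := D.B_surjective i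
    refine dotProduct_eq _ _ fun w => ?_
    obtain ⟨x, hx⟩ := hsurj (WithLp.toLp 2 w)
    rw [← D.toEuclideanLin_mat] at hx
    have hw : w = D.mat i *ᵥ x.ofLp := by
      have := congrArg WithLp.ofLp hx
      simpa using this.symm
    rw [hw, dotProduct_mulVec, dotProduct_mulVec]
    simp only at huv
    rw [huv]

/-- After the linear changes of variables given by the square roots of `A` and of the matrices
`B i A (B i)^*`, the datum becomes geometric. -/
lemma exists_geometric {A : Matrix (Fin n) (Fin n) ℝ} (hA : A.PosDef)
    (hA_eq : A⁻¹ = ∑ i, D.c i • ((D.mat i)ᵀ * (D.push A i)⁻¹ * D.mat i)) :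
    ∃ (R : Matrix (Fin n) (Fin n) ℝ) (S : ∀ i, Matrix (Fin (D.d i)) (Fin (D.d i)) ℝ)
      (Q : ∀ i, EuclideanSpace ℝ (Fin n) →L[ℝ] EuclideanSpace ℝ (Fin (D.d i))),
      (0 < R.det ∧ R.det ^ 2 = A.det) ∧
      (∀ i, 0 < (S i).det ∧ (S i).det ^ 2 = (D.push A i).det) ∧
      (∀ i x, D.B i (toEuclideanLin R x) = toEuclideanLin (S i) (Q i x)) ∧
      (∀ i u, ‖(Q i).adjoint u‖ = ‖u‖) ∧
      (∀ x, ∑ i, D.c i * ‖Q i x‖ ^ 2 = ‖x‖ ^ 2) ∧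
      ∀ i y, D.gaussian A i (toEuclideanLin (S i) y) = Real.exp (-‖y‖ ^ 2 / 2) := by
  obtain ⟨R, hRt, hRR, hRd⟩ := hA.exists_symmetric_sqrt
  choose S hSt hSS hSd using fun i => (D.posDef_push hA i).exists_symmetric_sqrt
  have hR' : IsUnit R.det := hRd.ne'.isUnit
  have hS' : ∀ i, IsUnit (S i).det := fun i => (hSd i).ne'.isUnit
  have hSit : ∀ i, ((S i)⁻¹)ᵀ = (S i)⁻¹ := fun i => by rw [transpose_nonsing_inv, hSt]
  have hinv : ∀ i, (D.push A i)⁻¹ = (S i)⁻¹ * (S i)⁻¹ := fun i => by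
    rw [← hSS i, Matrix.mul_inv_rev]
  set N : ∀ i, Matrix (Fin (D.d i)) (Fin n) ℝ := fun i => (S i)⁻¹ * D.mat i * R with hN
  have hNt : ∀ i, (N i)ᵀ = R * (D.mat i)ᵀ * (S i)⁻¹ := fun i => by
    simp only [hN, transpose_mul, hRt, hSit, Matrix.mul_assoc]
  have hNN : ∀ i, N i * (N i)ᵀ = 1 := fun i => by
    calc N i * (N i)ᵀ = (S i)⁻¹ * (D.mat i * (R * R) * (D.mat i)ᵀ) * (S i)⁻¹ := by
          rw [hNt]; simp only [hN, Matrix.mul_assoc]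
      _ = (S i)⁻¹ * (S i * S i) * (S i)⁻¹ := by rw [hRR, hSS]; rfl
      _ = 1 := by
          rw [← Matrix.mul_assoc, nonsing_inv_mul _ (hS' i), Matrix.one_mul,
            mul_nonsing_inv _ (hS' i)]
  have hsum : ∑ i, D.c i • ((N i)ᵀ * N i) = 1 := by
    have h1 : ∀ i, D.c i • ((N i)ᵀ * N i) =
        R * (D.c i • ((D.mat i)ᵀ * (D.push A i)⁻¹ * D.mat i)) * R := fun i => by
      rw [hNt, hinv, Matrix.mul_smul, Matrix.smul_mul]
      simp only [hN, Matrix.mul_assoc]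
    simp_rw [h1]
    rw [← Finset.sum_mul, ← Finset.mul_sum, ← hA_eq, ← hRR, Matrix.mul_inv_rev,
      ← Matrix.mul_assoc, mul_nonsing_inv _ hR', Matrix.one_mul, nonsing_inv_mul _ hR']
  refine ⟨R, S, fun i => (toEuclideanLin (N i)).toContinuousLinearMap, ⟨hRd, ?_⟩,
    fun i => ⟨hSd i, ?_⟩, fun i x => ?_, fun i u => ?_, fun x => ?_, fun i y => ?_⟩
  · rw [← hRR, det_mul, sq]
  · rw [← hSS i, det_mul, sq]
  · rw [LinearMap.coe_toContinuousLinearMap', ← toEuclideanLin_mul_apply, ← D.toEuclideanLin_mat,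
      ← toEuclideanLin_mul_apply]
    congr 2
    simp only [hN, Matrix.mul_assoc]
    rw [← Matrix.mul_assoc, mul_nonsing_inv _ (hS' i), Matrix.one_mul]
  · have had : ∀ v, (toEuclideanLin (N i)).toContinuousLinearMap.adjoint v =
        toEuclideanLin (N i)ᵀ v := fun v => by
      refine ext_inner_left ℝ fun z => ?_
      rw [ContinuousLinearMap.adjoint_inner_right, LinearMap.coe_toContinuousLinearMap',
        inner_toEuclideanLin_left]
    have h2 : ‖toEuclideanLin (N i)ᵀ u‖ ^ 2 = ‖u‖ ^ 2 := by
      rw [← real_inner_self_eq_norm_sq, inner_toEuclideanLin_left, transpose_transpose,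
        ← toEuclideanLin_mul_apply, hNN, toEuclideanLin_one_apply, real_inner_self_eq_norm_sq]
    rw [had]
    exact (pow_left_inj₀ (norm_nonneg _) (norm_nonneg _) two_ne_zero).1 h2
  · have h2 : ∀ i, D.c i * ‖toEuclideanLin (N i) x‖ ^ 2 =
        ⟪x, toEuclideanLin (D.c i • ((N i)ᵀ * N i)) x⟫ := fun i => by
      rw [map_smul, LinearMap.smul_apply, real_inner_smul_right,
        toEuclideanLin_mul_apply (N i)ᵀ (N i),
        ← inner_toEuclideanLin_left, real_inner_self_eq_norm_sq]
    simp_rw [LinearMap.coe_toContinuousLinearMap', h2]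
    rw [← inner_sum, ← LinearMap.sum_apply, ← map_sum, hsum, toEuclideanLin_one_apply,
      real_inner_self_eq_norm_sq]
  · rw [gaussian, ← toEuclideanLin_mul_apply, hinv, Matrix.mul_assoc, nonsing_inv_mul _ (hS' i),
      Matrix.mul_one, ← hSit i, inner_toEuclideanLin_left, transpose_transpose,
      ← toEuclideanLin_mul_apply, nonsing_inv_mul _ (hS' i), toEuclideanLin_one_apply,
      real_inner_self_eq_norm_sq]

end BLDatum

theorem theorem1 {n m : ℕ} (D : BLDatum n m)
    (homogeneity : ∑ i, D.c i * (D.d i : ℝ) = (n : ℝ))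
    (A : Matrix (Fin n) (Fin n) ℝ) (hA : A.PosDef)
    (hA_eq : A⁻¹ = ∑ i, D.c i • ((D.mat i).transpose * (D.push A i)⁻¹ * D.mat i)) :
    D.IsConstant ((A.det / ∏ i, (D.push A i).det ^ D.c i) ^ (1 / 2 : ℝ)) ∧
      (∀ i, Integrable (D.gaussian A i)) ∧
      Integrable (D.integrand (D.gaussian A)) ∧
      ∫ x, D.integrand (D.gaussian A) x =
        (A.det / ∏ i, (D.push A i).det ^ D.c i) ^ (1 / 2 : ℝ) *
          ∏ i, (∫ y, D.gaussian A i y) ^ D.c i := by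
  obtain ⟨R, S, Q, ⟨hRd, hRA⟩, hS, hBQ, hQ, hI, hgauss⟩ := D.exists_geometric hA hA_eq
  have hc : ∀ i, 0 ≤ D.c i := fun i => (D.c_pos i).le
  have hdim : ∑ i, D.c i * (Module.finrank ℝ (EuclideanSpace ℝ (Fin (D.d i))) : ℝ) =
      Module.finrank ℝ (EuclideanSpace ℝ (Fin n)) := by simpa using homogeneity
  have hdetR : LinearMap.det (Matrix.toEuclideanLin R) = R.det := LinearMap.det_toLpLin 2 R
  have hdetS : ∀ i, LinearMap.det (Matrix.toEuclideanLin (S i)) = (S i).det :=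
    fun i => LinearMap.det_toLpLin 2 (S i)
  have chR := fun f => integrable_comp_linearMap_iff_and_integral_eq (f := f) (hdetR.symm ▸ hRd)
  have chS := fun i f => integrable_comp_linearMap_iff_and_integral_eq (f := f)
    ((hdetS i).symm ▸ (hS i).1)
  simp only [hdetR] at chR
  simp only [hdetS] at chS
  set P := ∏ i, (S i).det ^ D.c i with hP
  have hP0 : 0 < P := Finset.prod_pos fun i _ => Real.rpow_pos_of_pos (hS i).1 _
  have hC : (A.det / ∏ i, (D.push A i).det ^ D.c i) ^ (1 / 2 : ℝ) = R.det / P := by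
    have h1 : ∏ i, (D.push A i).det ^ D.c i = P ^ 2 := by
      rw [hP, ← Finset.prod_pow]
      refine Finset.prod_congr rfl fun i _ => ?_
      rw [← (hS i).2, ← Real.rpow_natCast, ← Real.rpow_natCast, ← Real.rpow_mul (hS i).1.le,
        ← Real.rpow_mul (hS i).1.le, mul_comm]
    rw [h1, ← hRA, ← div_pow, ← Real.sqrt_eq_rpow, Real.sqrt_sq (by positivity)]
  rw [hC]
  have hintegrand : ∀ f x, D.integrand f (Matrix.toEuclideanLin R x) =
      ∏ i, f i (Matrix.toEuclideanLin (S i) (Q i x)) ^ D.c i := fun f x => by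
    simp only [BLDatum.integrand, hBQ]
  have hineq : D.InequalityHolds (R.det / P) := by
    intro f hf0 hf
    have h := integral_prod_rpow_le_of_geometric hc Q hQ hI hdim
      (f := fun i y => f i (Matrix.toEuclideanLin (S i) y)) (fun i y => hf0 i _)
      (fun i => (chS i (f i)).1.2 (hf i))
    simp_rw [← hintegrand] at h
    refine ⟨(chR _).1.1 h.1, ?_⟩
    have hprod : ∏ i, (∫ y, f i y) ^ D.c i =
        P * ∏ i, (∫ y, f i (Matrix.toEuclideanLin (S i) y)) ^ D.c i := by
      rw [hP, ← Finset.prod_mul_distrib]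
      refine Finset.prod_congr rfl fun i _ => ?_
      rw [(chS i (f i)).2, Real.mul_rpow (hS i).1.le (integral_nonneg fun y => hf0 i _)]
    rw [(chR _).2, hprod, ← mul_assoc, div_mul_cancel₀ _ hP0.ne']
    exact mul_le_mul_of_nonneg_left h.2 hRd.le
  have hgi : ∀ i, Integrable (D.gaussian A i) := fun i => by
    rw [← (chS i _).1]
    simp_rw [hgauss]
    exact integrable_exp_neg_norm_sq_div_two
  have hgint : ∀ i, ∫ y, D.gaussian A i y =
      (S i).det * gaussianMass (EuclideanSpace ℝ (Fin (D.d i))) := fun i => by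
    rw [(chS i _).2]
    simp_rw [hgauss]
    rw [integral_exp_neg_norm_sq_div_two]
  have hglhs : ∫ x, D.integrand (D.gaussian A) x =
      R.det * gaussianMass (EuclideanSpace ℝ (Fin n)) := by
    rw [(chR _).2, ← integral_exp_neg_norm_sq_div_two]
    congr 2 with x
    rw [hintegrand, ← hI x, ← Finset.sum_neg_distrib, Finset.sum_div, Real.exp_sum]
    refine Finset.prod_congr rfl fun i _ => ?_
    rw [hgauss, ← Real.exp_mul]
    congr 1
    ring
  have hgprod : ∏ i, (∫ y, D.gaussian A i y) ^ D.c i =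
      P * gaussianMass (EuclideanSpace ℝ (Fin n)) := by
    rw [hP, ← prod_gaussianMass_rpow hdim, ← Finset.prod_mul_distrib]
    refine Finset.prod_congr rfl fun i _ => ?_
    rw [hgint, Real.mul_rpow (hS i).1.le gaussianMass_pos.le]
  have hgeq : ∫ x, D.integrand (D.gaussian A) x =
      R.det / P * ∏ i, (∫ y, D.gaussian A i y) ^ D.c i := by
    rw [hglhs, hgprod, ← mul_assoc, div_mul_cancel₀ _ hP0.ne']
  have hg0 : ∀ i x, 0 ≤ D.gaussian A i x := fun i x => (Real.exp_pos _).le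
  refine ⟨⟨hineq, fun C' hC' => ?_⟩, hgi, (hineq _ hg0 hgi).1, hgeq⟩
  -- the Gaussian functions attain equality, so no smaller constant is possible
  have h := (hC' _ hg0 hgi).2
  rw [hgeq] at h
  refine le_of_mul_le_mul_right h ?_
  rw [hgprod]
  exact mul_pos hP0 gaussianMass_pos
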